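/- Let $\Omega\subset\mathbb{R}^2$ be a bounded open set. Let $\gamma>0$, $s_0\ge 0$, $\kappa\ge-\gamma s_0$, and let $\rho\in C^\infty(\mathbb{R})$ satisfy $\rho(s)=0$ for $s\le 0$, $\rho(s)=\gamma s+\kappa$ for $s\ge s_0$, and $\rho$ is convex on $[0,s_0]$. For $u\in W^{1,2}(\Omega,\mathbb{R}^2)$ put $$I(u)=\int_\Omega \tfrac12|\nabla u|^2+\rho(\det\nabla u)\,dx ,$$ where $|\cdot|$ is the Frobenius norm. Call $u\in W^{1,2}(\Omega,\mathbb{R}^2)$ a stationary point of $I$ if $\frac{d}{d\varepsilon}\big|_{\varepsilon=0}I(u+\varepsilon\varphi)=0$ for every $\varphi\in C_c^\infty(\Omega,\mathbb{R}^2)$. If $0<\gamma<1$, then every stationary point $u\in W^{1,2}(\Omega,\mathbb{R}^2)$ of $I$ belongs to $W^{2,2}_{\mathrm{loc}}(\Omega,\mathbb{R}^2)$, that is, $u\in W^{2,2}(V,\mathbb{R}^2)$ for every open $V$ whose closure is a compact subset of $\Omega$. -/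

import Mathlib

open MeasureTheory Set
open scoped ContDiff ENNReal

/-- The plane `ℝ²` with its Euclidean norm. -/
abbrev Plane : Type := EuclideanSpace ℝ (Fin 2)

/-- `φ ∈ C_c^∞(Ω, F)`: a smooth function whose (compact) support lies in `Ω`. -/
structure IsTestFunction {F : Type*} [NormedAddCommGroup F] [NormedSpace ℝ F]
    (Ω : Set Plane) (φ : Plane → F) : Prop where
  smooth : ContDiff ℝ ∞ φ
  compact : HasCompactSupport φ
  support_subset : tsupport φ ⊆ Ω

/-- `g` is the weak partial derivative `∂_j f` on the open set `Ω`: both functions are locally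
integrable on `Ω`, and `∫_Ω (∂_j φ) f = - ∫_Ω φ g` for all real `φ ∈ C_c^∞(Ω)`. -/
structure HasWeakPartial {F : Type*} [NormedAddCommGroup F] [NormedSpace ℝ F]
    (Ω : Set Plane) (f : Plane → F) (j : Fin 2) (g : Plane → F) : Prop where
  locallyIntegrable : LocallyIntegrableOn f Ω
  locallyIntegrable_partial : LocallyIntegrableOn g Ω
  integral_eq : ∀ φ : Plane → ℝ, IsTestFunction Ω φ →
    ∫ x in Ω, (fderiv ℝ φ x (EuclideanSpace.single j 1)) • f x = - ∫ x in Ω, φ x • g x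

/-- `f ∈ W^{k,p}(Ω, F)`: `f` and all its weak derivatives of order at most `k` are in `L^p(Ω)`. -/
def MemSobolev {F : Type*} [NormedAddCommGroup F] [NormedSpace ℝ F] (p : ℝ≥0∞)
    (Ω : Set Plane) : ℕ → (Plane → F) → Prop
  | 0, f => MemLp f p (volume.restrict Ω)
  | k + 1, f => MemLp f p (volume.restrict Ω) ∧
      ∀ j : Fin 2, ∃ g : Plane → F, HasWeakPartial Ω f j g ∧ MemSobolev p Ω k g

/-- `f ∈ W^{k,p}_loc(Ω, F)`: `f ∈ W^{k,p}(V, F)` for every open `V` that is compactly contained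
in `Ω`. -/
def MemSobolevLoc {F : Type*} [NormedAddCommGroup F] [NormedSpace ℝ F] (p : ℝ≥0∞)
    (Ω : Set Plane) (k : ℕ) (f : Plane → F) : Prop :=
  ∀ V : Set Plane, IsOpen V → IsCompact (closure V) → closure V ⊆ Ω → MemSobolev p V k f

open Classical in
/-- The weak partial derivative `∂_j f` on `Ω` (a representative of it, unique almost everywhere
in `Ω`); zero if there is none. -/
noncomputable def weakPartial {F : Type*} [NormedAddCommGroup F] [NormedSpace ℝ F]
    (Ω : Set Plane) (f : Plane → F) (j : Fin 2) : Plane → F :=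
  if h : ∃ g, HasWeakPartial Ω f j g then h.choose else 0

/-- The weak gradient of `u : Ω → ℝ²`, with entries `(∇u)_{ij} = ∂_j u^i`. -/
noncomputable def weakGrad (Ω : Set Plane) (u : Plane → Plane) (x : Plane) :
    Matrix (Fin 2) (Fin 2) ℝ :=
  Matrix.of fun i j => weakPartial Ω u j x i

/-- The integrand `W(ξ) = ½ |ξ|² + ρ(det ξ)`, with the Frobenius norm `|ξ|`. -/
noncomputable def integrand (ρ : ℝ → ℝ) (ξ : Matrix (Fin 2) (Fin 2) ℝ) : ℝ :=
  (1 / 2) * (∑ i, ∑ j, ξ i j ^ 2) + ρ ξ.det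

/-- The functional `I(u) = ∫_Ω ½ |∇u|² + ρ(det ∇u) dx`. -/
noncomputable def energy (ρ : ℝ → ℝ) (Ω : Set Plane) (u : Plane → Plane) : ℝ :=
  ∫ x in Ω, integrand ρ (weakGrad Ω u x)

/-- `u ∈ W^{1,2}(Ω, ℝ²)` is a stationary point of the functional: its first variation
`d/dε I(u + ε φ)` at `ε = 0` exists and vanishes for all `φ ∈ C_c^∞(Ω, ℝ²)`. -/
structure IsStationaryPoint (ρ : ℝ → ℝ) (Ω : Set Plane) (u : Plane → Plane) : Prop where
  memSobolev : MemSobolev 2 Ω 1 u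
  firstVariation : ∀ φ : Plane → Plane, IsTestFunction Ω φ →
    HasDerivAt (fun ε : ℝ => energy ρ Ω (fun x => u x + ε • φ x)) 0 0

/-- The class of functions `ρ ∈ C^∞(ℝ)` with `ρ(s) = 0` for `s ≤ 0`, `ρ` convex on `[0, s₀]`, and
`ρ(s) = γ s + κ` for `s ≥ s₀`, where `γ > 0`, `s₀ ≥ 0` and `κ ≥ -γ s₀`. -/
structure IsProfile (ρ : ℝ → ℝ) (γ s₀ κ : ℝ) : Prop where
  gamma_pos : 0 < γ
  s₀_nonneg : 0 ≤ s₀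
  le_kappa : -γ * s₀ ≤ κ
  smooth : ContDiff ℝ ∞ ρ
  eq_zero : ∀ s ≤ 0, ρ s = 0
  convex : ConvexOn ℝ (Icc 0 s₀) ρ
  eq_affine : ∀ s, s₀ ≤ s → ρ s = γ * s + κ

open Filter Topology

/-! A stationary point solves `div A(∇u) = 0` weakly, with `A(ξ) = ξ + ρ'(det ξ) cof ξ`, and the
method is Nirenberg's difference quotients. Monotonicity is available: `ρ'` increases from `0` to
`γ` and `|det N| ≤ |N|²/2`, so `(A(ξ') - A(ξ)) : (ξ' - ξ)` is at least `(1 - γ)|ξ' - ξ|²` plus the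
nonnegative term `(ρ'(det ξ') - ρ'(det ξ))(det ξ' - det ξ)` (`stress_monotone`).

The obstacle is that `A` is not globally Lipschitz in general: its derivative contains `ρ''(det ξ)
cof ξ ⊗ cof ξ`. Testing the differenced equation with `η²` times the increment `a = u(x + h e_k) -
u(x)` leaves the cross term `(A(ξ') - A(ξ)) : (a ⊗ ∇η²)`, whose bad part is `(ρ'(det ξ') - ρ'(det
ξ)) cof ξ : (a ⊗ ∇η²)`. Replace `a` by `h ξ e_k`. Since `ξᵀ cof ξ = (det ξ) 1`, this part becomes a
scalar expression in the determinants: the increment of `G(s) = s ρ'(s) - ρ(s)` minus a convexity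
defect (`stress_cross_term`). The increment of `G` is integrated by parts discretely onto the
cutoff, and the defect is absorbed by the extra monotone term.

What remains is the Taylor remainder `a - h ξ e_k`. Its localized `L²` norm is at most `h` times the
supremum over `s ≤ h` of the localized norm of the increments of `∇u`. With `Q(h)` the localized
squared increment of `∇u`, this gives `Q(h) ≤ C h² + C h sup √Q`
(`IsWeakSolution.localizedDiffSq_le`), which improves itself to `Q(h) ≤ C' h²`
(`le_sq_of_self_improving`). Bounded difference quotients then yield the second weak derivatives
through the Riesz representation theorem (`exists_weakDeriv_of_diff_bound`). -/

/-! ### Averages, translations and cutoffs in `L²`. -/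

theorem eLpNorm_two_sq {X : Type*} [MeasurableSpace X] (μ : Measure X) (f : X → ℝ) :
    eLpNorm f 2 μ ^ 2 = ∫⁻ x, ‖f x‖ₑ ^ 2 ∂μ := by
  have := eLpNorm_nnreal_pow_eq_lintegral (μ := μ) (f := f) (p := 2) (by norm_num)
  simp only [NNReal.coe_ofNat, ENNReal.coe_ofNat, ENNReal.rpow_ofNat] at this
  exact this

/-- Minkowski's inequality for averages, in `L²`. -/
theorem eLpNorm_two_average_le {T X : Type*} [MeasurableSpace T] [MeasurableSpace X]
    {ν : Measure T} [IsProbabilityMeasure ν] {μ : Measure X} [SFinite μ] {F : T → X → ℝ}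
    (hF : AEStronglyMeasurable (fun q : T × X => F q.1 q.2) (ν.prod μ)) {M : ℝ≥0∞}
    (hM : ∀ᵐ t ∂ν, eLpNorm (F t) 2 μ ≤ M) :
    eLpNorm (fun x => ∫ t, F t x ∂ν) 2 μ ≤ M := by
  rw [← ENNReal.pow_le_pow_left_iff two_ne_zero, eLpNorm_two_sq]
  calc ∫⁻ x, ‖∫ t, F t x ∂ν‖ₑ ^ 2 ∂μ
      ≤ ∫⁻ x, ∫⁻ t, ‖F t x‖ₑ ^ 2 ∂ν ∂μ := by
        -- For fixed `x` this is `L¹ ≤ L²` with respect to the probability measure `ν`; Tonelli then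
        -- exchanges the two integrals.
        refine lintegral_mono_ae ?_
        have h1 := hF.prod_swap.prodMk_left
        filter_upwards [h1] with x hx
        have hx' : AEStronglyMeasurable (fun t => F t x) ν := hx
        rw [← eLpNorm_two_sq]
        gcongr
        calc ‖∫ t, F t x ∂ν‖ₑ ≤ ∫⁻ t, ‖F t x‖ₑ ∂ν := enorm_integral_le_lintegral_enorm _
          _ = eLpNorm (fun t => F t x) 1 ν := eLpNorm_one_eq_lintegral_enorm.symm
          _ ≤ _ := eLpNorm_le_eLpNorm_of_exponent_le (by norm_num) hx'
    _ = ∫⁻ t, ∫⁻ x, ‖F t x‖ₑ ^ 2 ∂μ ∂ν := by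
        rw [lintegral_lintegral_swap]
        exact (hF.prod_swap.enorm.pow_const 2)
    _ ≤ ∫⁻ _, M ^ 2 ∂ν := by
        refine lintegral_mono_ae ?_
        filter_upwards [hM] with t ht
        rw [← eLpNorm_two_sq]
        gcongr
    _ = M ^ 2 := by simp

theorem MeasureTheory.MemLp.comp_add_right_plane {f : Plane → ℝ} {p : ℝ≥0∞} (hf : MemLp f p volume)
    (y : Plane) : MemLp (fun x => f (x + y)) p volume :=
  hf.comp_measurePreserving (measurePreserving_add_right volume y)

/-- Continuity of translations in `L²`. -/
theorem tendsto_eLpNorm_translate_sub {f : Plane → ℝ} (hf : MemLp f 2 volume) :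
    Tendsto (fun y : Plane => eLpNorm (fun x => f (x + y) - f x) 2 volume) (𝓝 0) (𝓝 0) := by
  -- Translations form a continuous family for the compact-open topology, and composition with
  -- measure-preserving maps is continuous on `Lp` in that topology.
  let G : C(Plane, C(Plane, Plane)) :=
    (ContinuousMap.mk (fun q : Plane × Plane => q.2 + q.1) (by fun_prop)).curry
  have hG : ∀ y, MeasurePreserving (G y) volume volume := fun y =>
    measurePreserving_add_right volume y
  have hc := (continuous_const (y := hf.toLp f)).compMeasurePreservingLp G.continuous hG (by simp)
  have h0 := (hc.tendsto 0)
  have h1 := tendsto_iff_edist_tendsto_0.1 h0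
  refine h1.congr fun y => ?_
  have e : ∀ y, Lp.compMeasurePreserving (G y) (hG y) (hf.toLp f)
      = (hf.comp_add_right_plane y).toLp _ := fun y => by
    rw [Lp.toLp_compMeasurePreserving]; rfl
  rw [e, e, Lp.edist_toLp_toLp]
  congr 1
  ext x
  simp

theorem exists_cutoff {K U : Set Plane} (hK : IsCompact K) (hU : IsOpen U) (hKU : K ⊆ U) :
    ∃ η : Plane → ℝ, IsTestFunction U η ∧ (∀ x, 0 ≤ η x) ∧ (∀ x, η x ≤ 1) ∧ ∀ x ∈ K, η x = 1 := by
  obtain ⟨δ, hδ, hδU⟩ := hK.exists_cthickening_subset_open hU hKU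
  obtain ⟨f, hf0, hf1, hf⟩ := exists_contMDiffMap_zero_one_nhds_of_isClosed (n := (⊤ : ℕ∞))
    (modelWithCornersSelf ℝ Plane)
    (s := (Metric.thickening δ K)ᶜ) (t := K) Metric.isOpen_thickening.isClosed_compl hK.isClosed
    (disjoint_compl_left_iff_subset.2 (Metric.self_subset_thickening hδ K))
  have hs : tsupport f ⊆ Metric.cthickening δ K := by
    refine closure_minimal (fun x hx => ?_) Metric.isClosed_cthickening
    by_contra hx'
    have : x ∈ (Metric.thickening δ K)ᶜ := fun h => hx' (Metric.thickening_subset_cthickening _ _ h)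
    exact hx (hf0.self_of_nhdsSet x this)
  refine ⟨f, ⟨f.contMDiff.contDiff, ?_, hs.trans hδU⟩, fun x => (hf x).1, fun x => (hf x).2,
    fun x hx => hf1.self_of_nhdsSet x hx⟩
  exact HasCompactSupport.of_support_subset_isCompact hK.cthickening
    ((subset_tsupport _).trans hs)

/-! ### Mollification and Friedrichs' approximation. -/

/-- The standard basis vector `e_j` of the plane. -/
noncomputable abbrev unitVec (j : Fin 2) : Plane := EuclideanSpace.single j 1

/-- The mollification of `f` by the bump function `b`. -/
noncomputable def mollify (b : ContDiffBump (0 : Plane)) (f : Plane → ℝ) (x : Plane) : ℝ :=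
  ∫ t, b.normed volume t * f (x - t)

theorem mollify_eq_convolution (b : ContDiffBump (0 : Plane)) (f : Plane → ℝ) :
    mollify b f = convolution (b.normed volume) f (ContinuousLinearMap.lsmul ℝ ℝ) volume := by
  ext x
  simp [mollify, convolution]

theorem contDiff_mollify (b : ContDiffBump (0 : Plane)) {f : Plane → ℝ}
    (hf : LocallyIntegrable f volume) : ContDiff ℝ ∞ (mollify b f) := by
  rw [mollify_eq_convolution]
  exact b.hasCompactSupport_normed.contDiff_convolution_left _ b.contDiff_normed hf

theorem isTestFunction_normed_sub (b : ContDiffBump (0 : Plane)) {Ω : Set Plane} {x : Plane}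
    (hx : Metric.closedBall x b.rOut ⊆ Ω) :
    IsTestFunction Ω (fun y => b.normed volume (x - y)) := by
  have hs : tsupport (fun y => b.normed volume (x - y)) ⊆ Metric.closedBall x b.rOut := by
    refine closure_minimal (fun y hy => ?_) Metric.isClosed_closedBall
    have : x - y ∈ Function.support (b.normed (volume : Measure Plane)) := hy
    rw [b.support_normed_eq] at this
    rw [mem_ball_zero_iff] at this
    rw [Metric.mem_closedBall, dist_comm, dist_eq_norm]
    exact this.le
  exact ⟨b.contDiff_normed.comp (contDiff_const.sub contDiff_id),
    HasCompactSupport.of_support_subset_isCompact (isCompact_closedBall _ _)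
      ((subset_tsupport _).trans hs), hs.trans hx⟩

/-- The derivative falls on the kernel, and `y ↦ b(x - y)` is an admissible test function as soon as
the closed ball of radius `b.rOut` about `x` lies in `Ω`. The sign from the reflection cancels the
sign in the weak identity. -/
theorem fderiv_mollify (b : ContDiffBump (0 : Plane)) {f g : Plane → ℝ}
    (hf : LocallyIntegrable f volume) {Ω : Set Plane} {j : Fin 2}
    (hw : ∀ φ : Plane → ℝ, IsTestFunction Ω φ →
      ∫ x, fderiv ℝ φ x (unitVec j) * f x = -∫ x, φ x * g x)
    {x : Plane} (hx : Metric.closedBall x b.rOut ⊆ Ω) :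
    fderiv ℝ (mollify b f) x (unitVec j) = mollify b g x := by
  have hb : ContDiff ℝ 1 (b.normed (volume : Measure Plane)) := b.contDiff_normed
  rw [mollify_eq_convolution]
  rw [(b.hasCompactSupport_normed.hasFDerivAt_convolution_left (ContinuousLinearMap.lsmul ℝ ℝ)
    hb hf x).fderiv]
  have hint : ConvolutionExistsAt (fderiv ℝ (b.normed (volume : Measure Plane))) f x
      ((ContinuousLinearMap.lsmul ℝ ℝ).precompL Plane) volume :=
    (b.hasCompactSupport_normed.fderiv ℝ).convolutionExists_left _
      (hb.continuous_fderiv (by norm_num)) hf x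
  rw [convolution, ContinuousLinearMap.integral_apply hint]
  have h1 := hw _ (isTestFunction_normed_sub b hx)
  have h2 : ∀ y, fderiv ℝ (fun y => b.normed (volume : Measure Plane) (x - y)) y (unitVec j)
      = - fderiv ℝ (b.normed (volume : Measure Plane)) (x - y) (unitVec j) := by
    intro y
    have hd : HasFDerivAt (fun y => b.normed (volume : Measure Plane) (x - y)) _ y :=
      ((hb.differentiable (by norm_num)) (x - y)).hasFDerivAt.comp y
        ((hasFDerivAt_id y).const_sub x)
    rw [hd.fderiv]
    simp
  simp only [h2, neg_mul, integral_neg, neg_inj] at h1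
  have e1 := integral_sub_left_eq_self
    (fun y => fderiv ℝ (b.normed (volume : Measure Plane)) (x - y) (unitVec j) * f y) volume x
  have e2 := integral_sub_left_eq_self
    (fun y => b.normed (volume : Measure Plane) (x - y) * g y) volume x
  simp only [sub_sub_cancel] at e1 e2
  simp only [mollify, ContinuousLinearMap.precompL_apply, ContinuousLinearMap.lsmul_apply,
    smul_eq_mul]
  rw [e1, e2, h1]

/-- The normalized bump is a probability density, so `mollify b f - f` is an average of translation
differences of `f`, and Minkowski's inequality applies. -/
theorem eLpNorm_mollify_sub_le (b : ContDiffBump (0 : Plane)) {f : Plane → ℝ}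
    (hf : MemLp f 2 volume) {M : ℝ≥0∞}
    (hM : ∀ y : Plane, ‖y‖ < b.rOut → eLpNorm (fun x => f (x + y) - f x) 2 volume ≤ M) :
    eLpNorm (mollify b f - f) 2 volume ≤ M := by
  have hloc : LocallyIntegrable f volume := hf.locallyIntegrable (by norm_num)
  have hbm : Measurable fun t => ENNReal.ofReal (b.normed (volume : Measure Plane) t) :=
    b.continuous_normed.measurable.ennreal_ofReal
  let ν : Measure Plane := volume.withDensity fun t => ENNReal.ofReal (b.normed volume t)
  have hν : IsProbabilityMeasure ν := by
    constructor
    rw [withDensity_apply _ MeasurableSet.univ, Measure.restrict_univ,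
      ← ofReal_integral_eq_lintegral_ofReal (b.integrable_normed (μ := volume))
        (Eventually.of_forall (b.nonneg_normed (μ := volume))), b.integral_normed, ENNReal.ofReal_one]
  have hνi : ∀ h : Plane → ℝ, ∫ t, h t ∂ν = ∫ t, b.normed volume t * h t := by
    intro h
    rw [integral_withDensity_eq_integral_toReal_smul hbm (Eventually.of_forall fun _ => by simp)]
    refine integral_congr_ae (Eventually.of_forall fun t => ?_)
    simp [ENNReal.toReal_ofReal (b.nonneg_normed t)]
  have hac : ν ≪ volume := withDensity_absolutelyContinuous _ _
  have hmeas : AEStronglyMeasurable (fun q : Plane × Plane => f (q.2 - q.1) - f q.2)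
      (ν.prod volume) := by
    have hac2 : ν.prod (volume : Measure Plane) ≪ (volume : Measure Plane).prod volume :=
      hac.prod Measure.AbsolutelyContinuous.rfl
    refine AEStronglyMeasurable.mono_ac hac2 (AEStronglyMeasurable.sub ?_ ?_)
    · have := (quasiMeasurePreserving_sub_of_right_invariant (volume : Measure Plane)
        (volume : Measure Plane))
      exact (hf.1.comp_quasiMeasurePreserving this).prod_swap
    · exact hf.1.comp_quasiMeasurePreserving Measure.quasiMeasurePreserving_snd
  have h := eLpNorm_two_average_le (F := fun t x => f (x - t) - f x) hmeas (M := M) ?_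
  · convert h using 2
    ext x
    rw [hνi]
    simp only [mul_sub, Pi.sub_apply, mollify]
    rw [integral_sub, integral_mul_const, b.integral_normed, one_mul]
    · have := (b.hasCompactSupport_normed (μ := volume)).convolutionExists_left
        (μ := volume) (ContinuousLinearMap.lsmul ℝ ℝ) b.continuous_normed hloc x
      simpa [ConvolutionExistsAt] using this
    · exact (b.integrable_normed (μ := volume)).mul_const _
  · refine (ae_withDensity_iff hbm).2 (Eventually.of_forall fun t ht => ?_)
    have ht' : t ∈ Function.support (b.normed (volume : Measure Plane)) := fun h0 =>
      ht (by rw [h0]; simp)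
    rw [b.support_normed_eq, mem_ball_zero_iff] at ht'
    simpa [sub_eq_add_neg] using hM (-t) (by simpa using ht')

/-- Friedrichs' theorem: a function in `W^{1,2}(Ω)` is locally a limit of smooth functions. -/
theorem exists_smooth_approx {f : Plane → ℝ} {g : Fin 2 → Plane → ℝ} (hf : MemLp f 2 volume)
    (hg : ∀ j, MemLp (g j) 2 volume) {Ω K : Set Plane} (hΩ : IsOpen Ω) (hK : IsCompact K)
    (hKΩ : K ⊆ Ω)
    (hw : ∀ j, ∀ φ : Plane → ℝ, IsTestFunction Ω φ →
      ∫ x, fderiv ℝ φ x (unitVec j) * f x = -∫ x, φ x * g j x) :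
    ∃ v : ℕ → Plane → ℝ, (∀ n, ContDiff ℝ ∞ (v n)) ∧
      Tendsto (fun n => eLpNorm (v n - f) 2 (volume.restrict K)) atTop (𝓝 0) ∧
      ∀ j, Tendsto (fun n => eLpNorm ((fun x => fderiv ℝ (v n) x (unitVec j)) - g j) 2
        (volume.restrict K)) atTop (𝓝 0) := by
  obtain ⟨δ, hδ, hδΩ⟩ := hK.exists_cthickening_subset_open hΩ hKΩ
  -- The outer radii tend to `0` and never exceed `δ`, so balls about points of `K` stay in `Ω`.
  let b : ℕ → ContDiffBump (0 : Plane) := fun n =>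
    ⟨δ / (2 * (n + 1)), δ / (n + 1), by positivity, by
      have : (0 : ℝ) < n + 1 := by positivity
      rw [div_lt_div_iff_of_pos_left hδ (by positivity) this]; linarith⟩
  have hb : ∀ n, (b n).rOut = δ / (n + 1) := fun n => rfl
  have hb0 : Tendsto (fun n => (b n).rOut) atTop (𝓝 0) := by
    simp only [hb]
    exact tendsto_const_div_atTop_nhds_zero_nat δ |>.comp (tendsto_add_atTop_nat 1) |>.congr
      fun n => by simp
  have key : ∀ h : Plane → ℝ, MemLp h 2 volume →
      Tendsto (fun n => eLpNorm (mollify (b n) h - h) 2 volume) atTop (𝓝 0) := by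
    intro h hh
    rw [ENNReal.tendsto_nhds_zero]
    intro ε hε
    have h1 := (ENNReal.tendsto_nhds_zero.1 (tendsto_eLpNorm_translate_sub hh)) ε hε
    obtain ⟨r, hr, h2⟩ := Metric.eventually_nhds_iff.1 h1
    filter_upwards [hb0.eventually (gt_mem_nhds hr)] with n hn
    exact eLpNorm_mollify_sub_le (b n) hh fun y hy => h2 (by simpa using hy.trans hn)
  have hloc : LocallyIntegrable f volume := hf.locallyIntegrable (by norm_num)
  refine ⟨fun n => mollify (b n) f, fun n => contDiff_mollify _ hloc, ?_, fun j => ?_⟩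
  · exact tendsto_of_tendsto_of_tendsto_of_le_of_le tendsto_const_nhds (key f hf)
      (fun _ => zero_le) fun n => eLpNorm_mono_measure _ Measure.restrict_le_self
  · refine tendsto_of_tendsto_of_tendsto_of_le_of_le tendsto_const_nhds (key (g j) (hg j))
      (fun _ => zero_le) fun n => ?_
    refine le_trans (le_of_eq (eLpNorm_congr_ae ?_))
      (eLpNorm_mono_measure _ Measure.restrict_le_self)
    refine (ae_restrict_iff' hK.measurableSet).2 (Eventually.of_forall fun x hx => ?_)
    have hball : Metric.closedBall x (b n).rOut ⊆ Ω := by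
      refine Subset.trans ?_ hδΩ
      refine (Metric.closedBall_subset_closedBall ?_).trans
        (Metric.closedBall_subset_cthickening hx δ)
      rw [hb]
      exact div_le_self hδ.le (by simp)
    simp only [Pi.sub_apply]
    rw [fderiv_mollify (b n) hloc (hw j) hball]

/-! ### `L²` bounds for increments and Taylor remainders. -/

/-- The integral over `(0, h]` is `h` times the average against the uniform law, so Minkowski's
inequality for averages gives the factor `h`. -/
theorem eLpNorm_two_intervalIntegral_le {D : ℝ → Plane → ℝ} {ψ : Plane → ℝ}
    (hD : Continuous fun q : ℝ × Plane => D q.1 q.2) (hψ : Measurable ψ) {h : ℝ} (hh : 0 < h)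
    {M : ℝ≥0∞}
    (hM : ∀ s ∈ Ioc 0 h, eLpNorm (fun x => ψ x * D s x) 2 volume ≤ M) :
    eLpNorm (fun x => ψ x * ∫ s in (0 : ℝ)..h, D s x) 2 volume ≤ ENNReal.ofReal h * M := by
  have h0 : ENNReal.ofReal h ≠ 0 := by simpa using hh
  let ν : Measure ℝ := (ENNReal.ofReal h)⁻¹ • volume.restrict (Ioc 0 h)
  have hν : IsProbabilityMeasure ν := by
    constructor
    simp [ν, ENNReal.inv_mul_cancel h0]
  have key := eLpNorm_two_average_le (ν := ν) (μ := (volume : Measure Plane))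
    (F := fun s x => ψ x * D s x) (M := M)
    (((hψ.comp measurable_snd).mul hD.measurable).aestronglyMeasurable)
    (Measure.ae_smul_measure ((ae_restrict_iff' measurableSet_Ioc).2
      (Eventually.of_forall hM)) _)
  have e : (fun x => ψ x * ∫ s in (0 : ℝ)..h, D s x)
      = h • fun x => ∫ s, ψ x * D s x ∂ν := by
    ext x
    simp only [ν, integral_smul_measure, Pi.smul_apply, smul_eq_mul, integral_const_mul,
      intervalIntegral.integral_of_le hh.le, ENNReal.toReal_inv, ENNReal.toReal_ofReal hh.le]
    field_simp
  rw [e, eLpNorm_const_smul, Real.enorm_eq_ofReal hh.le]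
  gcongr

theorem ContDiff.continuous_fderiv_plane_apply {v : Plane → ℝ} (hv : ContDiff ℝ ∞ v) (y : Plane) :
    Continuous fun x => fderiv ℝ v x y :=
  (hv.continuous_fderiv (by simp)).clm_apply continuous_const

theorem ContDiff.intervalIntegral_fderiv_line {v : Plane → ℝ} (hv : ContDiff ℝ ∞ v) (x y : Plane)
    (h : ℝ) : ∫ s in (0 : ℝ)..h, fderiv ℝ v (x + s • y) y = v (x + h • y) - v x := by
  have hd : ∀ s ∈ uIcc (0 : ℝ) h, HasDerivAt (fun s : ℝ => v (x + s • y))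
      (fderiv ℝ v (x + s • y) y) s := fun s _ => by
    have h1 : HasDerivAt (fun s : ℝ => x + s • y) y s := by
      simpa using ((hasDerivAt_id s).smul_const y).const_add x
    exact ((hv.differentiable (by simp)) (x + s • y)).hasFDerivAt.comp_hasDerivAt s h1
  rw [intervalIntegral.integral_eq_sub_of_hasDerivAt hd]
  · simp
  · exact ((hv.continuous_fderiv_plane_apply y).comp (by fun_prop)).intervalIntegrable _ _

theorem eLpNorm_two_smooth_diff_le {v : Plane → ℝ} (hv : ContDiff ℝ ∞ v) {ψ : Plane → ℝ}
    (hψ : Measurable ψ) {y : Plane} {h : ℝ} (hh : 0 < h) {M : ℝ≥0∞}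
    (hM : ∀ s ∈ Ioc 0 h, eLpNorm (fun x => ψ x * fderiv ℝ v (x + s • y) y) 2 volume ≤ M) :
    eLpNorm (fun x => ψ x * (v (x + h • y) - v x)) 2 volume ≤ ENNReal.ofReal h * M := by
  simp only [← hv.intervalIntegral_fderiv_line]
  exact eLpNorm_two_intervalIntegral_le (D := fun s x => fderiv ℝ v (x + s • y) y)
    ((hv.continuous_fderiv_plane_apply y).comp (by fun_prop)) hψ hh hM

/-- The remainder is the integral of the increments of the derivative along the segment. The weight
stays at the base point `x`, so the bound involves the same localized increments that are to be
estimated later. -/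
theorem eLpNorm_two_smooth_taylor_le {v : Plane → ℝ} (hv : ContDiff ℝ ∞ v) {ψ : Plane → ℝ}
    (hψ : Measurable ψ) {y : Plane} {h : ℝ} (hh : 0 < h) {M : ℝ≥0∞}
    (hM : ∀ s ∈ Ioc 0 h,
      eLpNorm (fun x => ψ x * (fderiv ℝ v (x + s • y) y - fderiv ℝ v x y)) 2 volume ≤ M) :
    eLpNorm (fun x => ψ x * (v (x + h • y) - v x - h * fderiv ℝ v x y)) 2 volume
      ≤ ENNReal.ofReal h * M := by
  have hc := hv.continuous_fderiv_plane_apply y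
  have e : ∀ x, v (x + h • y) - v x - h * fderiv ℝ v x y
      = ∫ s in (0 : ℝ)..h, (fderiv ℝ v (x + s • y) y - fderiv ℝ v x y) := fun x => by
    rw [intervalIntegral.integral_sub, hv.intervalIntegral_fderiv_line]
    · simp
    · exact (hc.comp (by fun_prop)).intervalIntegrable _ _
    · exact intervalIntegrable_const
  simp only [e]
  exact eLpNorm_two_intervalIntegral_le
    (D := fun s x => fderiv ℝ v (x + s • y) y - fderiv ℝ v x y)
    ((hc.comp (by fun_prop)).sub (hc.comp continuous_snd)) hψ hh hM

theorem eLpNorm_mul_translate_le {ψ w : Plane → ℝ} {K' : Set Plane} (hK' : MeasurableSet K')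
    (hψ1 : ∀ x, |ψ x| ≤ 1) {y : Plane} (hψ0 : ∀ x, ψ x ≠ 0 → x + y ∈ K')
    (hw : AEStronglyMeasurable w volume) :
    eLpNorm (fun x => ψ x * w (x + y)) 2 volume ≤ eLpNorm w 2 (volume.restrict K') := by
  rw [← eLpNorm_indicator_eq_eLpNorm_restrict hK',
    ← eLpNorm_comp_measurePreserving (hw.indicator hK') (measurePreserving_add_right volume y)]
  refine eLpNorm_mono fun x => ?_
  by_cases h0 : ψ x = 0
  · simp [h0]
  · simp only [Function.comp_apply, indicator_of_mem (hψ0 x h0), norm_mul]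
    exact mul_le_of_le_one_left (norm_nonneg _) (hψ1 x)

/-- `L²` estimates for first order Taylor remainders of Sobolev functions. -/
theorem sobolev_difference_estimates {f : Plane → ℝ} {g : Fin 2 → Plane → ℝ}
    (hf : MemLp f 2 volume) (hg : ∀ j, MemLp (g j) 2 volume) {Ω K' : Set Plane} (hΩ : IsOpen Ω)
    (hK' : IsCompact K') (hKΩ : K' ⊆ Ω)
    (hw : ∀ j, ∀ φ : Plane → ℝ, IsTestFunction Ω φ →
      ∫ x, fderiv ℝ φ x (unitVec j) * f x = -∫ x, φ x * g j x)
    {ψ : Plane → ℝ} (hψ : Measurable ψ) (hψ1 : ∀ x, |ψ x| ≤ 1) {k : Fin 2} {h : ℝ} (hh : 0 < h)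
    (hψ0 : ∀ x, ψ x ≠ 0 → ∀ s ∈ Icc 0 h, x + s • unitVec k ∈ K') :
    eLpNorm (fun x => ψ x * (f (x + h • unitVec k) - f x)) 2 volume
      ≤ ENNReal.ofReal h * eLpNorm (g k) 2 volume ∧
    ∀ M : ℝ≥0∞, (∀ s ∈ Ioc 0 h,
      eLpNorm (fun x => ψ x * (g k (x + s • unitVec k) - g k x)) 2 volume ≤ M) →
      eLpNorm (fun x => ψ x * (f (x + h • unitVec k) - f x - h * g k x)) 2 volume
        ≤ ENNReal.ofReal h * M := by
  -- Approximation in `L²(K')` is enough: where `ψ` is nonzero, the whole segment from `x` to `x + h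
  -- e_k` stays in `K'`. The errors `a n` and `b n` vanish in the limit.
  obtain ⟨v, hv, hva, hvb⟩ := exists_smooth_approx hf hg hΩ hK' hKΩ hw
  set a : ℕ → ℝ≥0∞ := fun n => eLpNorm (v n - f) 2 (volume.restrict K') with ha
  set b : ℕ → ℝ≥0∞ := fun n =>
    eLpNorm ((fun x => fderiv ℝ (v n) x (unitVec k)) - g k) 2 (volume.restrict K') with hb
  have hb0 : Tendsto b atTop (𝓝 0) := hvb k
  have mv : ∀ n, AEStronglyMeasurable (v n - f) volume := fun n =>
    (hv n).continuous.aestronglyMeasurable.sub hf.1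
  have md : ∀ n, AEStronglyMeasurable ((fun x => fderiv ℝ (v n) x (unitVec k)) - g k) volume :=
    fun n => ((hv n).continuous_fderiv_plane_apply _).aestronglyMeasurable.sub (hg k).1
  have tr : ∀ {w : Plane → ℝ}, AEStronglyMeasurable w volume → ∀ s ∈ Icc 0 h,
      eLpNorm (fun x => ψ x * w (x + s • unitVec k)) 2 volume
        ≤ eLpNorm w 2 (volume.restrict K') := fun hw s hs =>
    eLpNorm_mul_translate_le hK'.measurableSet hψ1 (fun x hx => hψ0 x hx s hs) hw
  have tr0 : ∀ {w : Plane → ℝ}, AEStronglyMeasurable w volume →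
      eLpNorm (fun x => ψ x * w x) 2 volume ≤ eLpNorm w 2 (volume.restrict K') := fun hw => by
    simpa using tr hw 0 ⟨le_rfl, hh.le⟩
  have shift : ∀ {w : Plane → ℝ}, AEStronglyMeasurable w volume → ∀ s : ℝ,
      AEStronglyMeasurable (fun x => ψ x * w (x + s • unitVec k)) volume := fun hw s =>
    hψ.aestronglyMeasurable.mul
      (hw.comp_measurePreserving (measurePreserving_add_right volume (s • unitVec k)))
  have shift0 : ∀ {w : Plane → ℝ}, AEStronglyMeasurable w volume →
      AEStronglyMeasurable (fun x => ψ x * w x) volume := fun hw => hψ.aestronglyMeasurable.mul hw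
  have hmem : h ∈ Icc 0 h := ⟨hh.le, le_rfl⟩
  have one_le : (1 : ℝ≥0∞) ≤ 2 := by norm_num
  have dv : ∀ n, AEStronglyMeasurable (fun x => fderiv ℝ (v n) x (unitVec k)) volume := fun n =>
    ((hv n).continuous_fderiv_plane_apply _).aestronglyMeasurable
  constructor
  · have bound : ∀ n, eLpNorm (fun x => ψ x * (f (x + h • unitVec k) - f x)) 2 volume
        ≤ a n + a n + ENNReal.ofReal h * (b n + eLpNorm (g k) 2 volume) := by
      intro n
      have e : (fun x => ψ x * (f (x + h • unitVec k) - f x))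
          = ((fun x => ψ x * (v n - f) x) - (fun x => ψ x * (v n - f) (x + h • unitVec k)))
            + fun x => ψ x * (v n (x + h • unitVec k) - v n x) := by
        ext x; simp; ring
      rw [e]
      refine (eLpNorm_add_le ((shift0 (mv n)).sub (shift (mv n) h)) ?_ one_le).trans ?_
      · simp only [mul_sub]; exact (shift (hv n).continuous.aestronglyMeasurable h).sub
          (shift0 (hv n).continuous.aestronglyMeasurable)
      refine add_le_add ((eLpNorm_sub_le (shift0 (mv n)) (shift (mv n) h) one_le).trans
        (add_le_add (tr0 (mv n)) (tr (mv n) h hmem))) ?_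
      refine eLpNorm_two_smooth_diff_le (hv n) hψ hh fun s hs => ?_
      refine (tr (dv n) s (Ioc_subset_Icc_self hs)).trans ?_
      have e2 : (fun x => fderiv ℝ (v n) x (unitVec k))
          = ((fun x => fderiv ℝ (v n) x (unitVec k)) - g k) + g k := by simp
      rw [e2]
      refine (eLpNorm_add_le (md n).restrict (hg k).1.restrict one_le).trans ?_
      exact add_le_add le_rfl (eLpNorm_mono_measure _ Measure.restrict_le_self)
    have lim : Tendsto (fun n => a n + a n + ENNReal.ofReal h * (b n + eLpNorm (g k) 2 volume))
        atTop (𝓝 (0 + 0 + ENNReal.ofReal h * (0 + eLpNorm (g k) 2 volume))) :=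
      (hva.add hva).add (ENNReal.Tendsto.const_mul (hb0.add tendsto_const_nhds)
        (Or.inr ENNReal.ofReal_ne_top))
    simpa using ge_of_tendsto' lim bound
  · intro M hM
    have bound : ∀ n, eLpNorm (fun x => ψ x * (f (x + h • unitVec k) - f x - h * g k x)) 2 volume
        ≤ a n + a n + ENNReal.ofReal h * b n + ENNReal.ofReal h * (b n + b n + M) := by
      intro n
      have e : (fun x => ψ x * (f (x + h • unitVec k) - f x - h * g k x))
          = (((fun x => ψ x * (v n - f) x) - (fun x => ψ x * (v n - f) (x + h • unitVec k)))
            + h • fun x => ψ x * ((fun x => fderiv ℝ (v n) x (unitVec k)) - g k) x)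
            + fun x => ψ x * (v n (x + h • unitVec k) - v n x
              - h * fderiv ℝ (v n) x (unitVec k)) := by
        ext x; simp; ring
      rw [e]
      have m1 := (shift0 (mv n)).sub (shift (mv n) h)
      have m2 := (shift0 (md n)).const_smul h
      refine (eLpNorm_add_le (m1.add m2) ?_ one_le).trans ?_
      · exact shift0 ((((hv n).continuous.comp (by fun_prop)).sub
          (hv n).continuous).aestronglyMeasurable.sub ((dv n).const_mul h))
      refine add_le_add ((eLpNorm_add_le m1 m2 one_le).trans (add_le_add
        ((eLpNorm_sub_le (shift0 (mv n)) (shift (mv n) h) one_le).trans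
        (add_le_add (tr0 (mv n)) (tr (mv n) h hmem))) ?_)) ?_
      · rw [eLpNorm_const_smul, Real.enorm_eq_ofReal hh.le]
        gcongr
        exact tr0 (md n)
      refine eLpNorm_two_smooth_taylor_le (hv n) hψ hh fun s hs => ?_
      have e2 : (fun x => ψ x * (fderiv ℝ (v n) (x + s • unitVec k) (unitVec k)
            - fderiv ℝ (v n) x (unitVec k)))
          = ((fun x => ψ x * ((fun x => fderiv ℝ (v n) x (unitVec k)) - g k) (x + s • unitVec k))
            - (fun x => ψ x * ((fun x => fderiv ℝ (v n) x (unitVec k)) - g k) x))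
            + fun x => ψ x * (g k (x + s • unitVec k) - g k x) := by
        ext x; simp; ring
      rw [e2]
      refine (eLpNorm_add_le ((shift (md n) s).sub (shift0 (md n))) ?_ one_le).trans
        (add_le_add ((eLpNorm_sub_le (shift (md n) s) (shift0 (md n)) one_le).trans
          (add_le_add (tr (md n) s (Ioc_subset_Icc_self hs)) (tr0 (md n)))) (hM s hs))
      simp only [mul_sub]; exact (shift (hg k).1 s).sub (shift0 (hg k).1)
    have lim : Tendsto (fun n => a n + a n + ENNReal.ofReal h * b n
        + ENNReal.ofReal h * (b n + b n + M)) atTop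
        (𝓝 (0 + 0 + ENNReal.ofReal h * 0 + ENNReal.ofReal h * (0 + 0 + M))) :=
      ((hva.add hva).add (ENNReal.Tendsto.const_mul hb0 (Or.inr ENNReal.ofReal_ne_top))).add
        (ENNReal.Tendsto.const_mul ((hb0.add hb0).add tendsto_const_nhds)
        (Or.inr ENNReal.ofReal_ne_top))
    simpa using ge_of_tendsto' lim bound

/-! ### Convexity and growth of the profile. -/

namespace IsProfile

variable {ρ : ℝ → ℝ} {γ s₀ κ : ℝ}

theorem differentiable (hρ : IsProfile ρ γ s₀ κ) : Differentiable ℝ ρ :=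
  hρ.smooth.differentiable (by simp)

theorem continuous_deriv (hρ : IsProfile ρ γ s₀ κ) : Continuous (deriv ρ) :=
  hρ.smooth.continuous_deriv (by simp)

theorem deriv_eq_zero (hρ : IsProfile ρ γ s₀ κ) {s : ℝ} (hs : s ≤ 0) : deriv ρ s = 0 := by
  have h1 : EqOn (deriv ρ) (fun _ => 0) (Iio 0) := fun x hx => by
    have : ρ =ᶠ[𝓝 x] fun _ => 0 := by
      filter_upwards [Iio_mem_nhds hx] with y hy using hρ.eq_zero y (le_of_lt hy)
    rw [this.deriv_eq]; simp
  have := h1.closure hρ.continuous_deriv continuous_const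
  rw [closure_Iio] at this
  exact this hs

theorem deriv_eq_gamma (hρ : IsProfile ρ γ s₀ κ) {s : ℝ} (hs : s₀ ≤ s) : deriv ρ s = γ := by
  have h1 : EqOn (deriv ρ) (fun _ => γ) (Ioi s₀) := fun x hx => by
    have : ρ =ᶠ[𝓝 x] fun s => γ * s + κ := by
      filter_upwards [Ioi_mem_nhds hx] with y hy using hρ.eq_affine y (le_of_lt hy)
    rw [this.deriv_eq]; simp
  have := h1.closure hρ.continuous_deriv continuous_const
  rw [closure_Ioi] at this
  exact this hs

/-- Continuity of `ρ'` gives it the values `0` and `γ` also at the endpoints `0` and `s₀`, so the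
constant pieces glue to the convex piece. Hence `ρ` is convex on the whole line and `0 ≤ ρ' ≤ γ`. -/
theorem monotone_deriv (hρ : IsProfile ρ γ s₀ κ) : Monotone (deriv ρ) := by
  have h1 : MonotoneOn (deriv ρ) (Iic 0) := fun x hx y hy _ => by
    rw [hρ.deriv_eq_zero hx, hρ.deriv_eq_zero hy]
  have h2 : MonotoneOn (deriv ρ) (Icc 0 s₀) :=
    hρ.convex.monotoneOn_deriv fun x _ => hρ.differentiable x
  have h3 : MonotoneOn (deriv ρ) (Ici s₀) := fun x hx y hy _ => by
    rw [hρ.deriv_eq_gamma hx, hρ.deriv_eq_gamma hy]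
  have h4 := h1.union_right h2 isGreatest_Iic (isLeast_Icc hρ.s₀_nonneg)
  rw [Iic_union_Icc_eq_Iic hρ.s₀_nonneg] at h4
  exact h4.Iic_union_Ici h3

theorem deriv_nonneg (hρ : IsProfile ρ γ s₀ κ) (s : ℝ) : 0 ≤ deriv ρ s := by
  rw [← hρ.deriv_eq_zero (min_le_right s 0)]
  exact hρ.monotone_deriv (min_le_left _ _)

theorem deriv_le (hρ : IsProfile ρ γ s₀ κ) (s : ℝ) : deriv ρ s ≤ γ := by
  rw [← hρ.deriv_eq_gamma (le_max_right s s₀)]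
  exact hρ.monotone_deriv (le_max_left _ _)

theorem tangent_le (hρ : IsProfile ρ γ s₀ κ) (s t : ℝ) :
    ρ s + deriv ρ s * (t - s) ≤ ρ t := by
  have hc : ConvexOn ℝ univ ρ := hρ.monotone_deriv.convexOn_univ_of_deriv hρ.differentiable
  rcases lt_trichotomy s t with h | h | h
  · have := hc.deriv_le_slope (mem_univ s) (mem_univ t) h (hρ.differentiable s)
    rw [slope_def_field, le_div_iff₀ (by linarith)] at this
    linarith
  · simp [h]
  · have := hc.slope_le_deriv (mem_univ t) (mem_univ s) h (hρ.differentiable s)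
    rw [slope_def_field, div_le_iff₀ (by linarith)] at this
    linarith

theorem nonneg (hρ : IsProfile ρ γ s₀ κ) (s : ℝ) : 0 ≤ ρ s := by
  have := hρ.tangent_le 0 s
  rw [hρ.deriv_eq_zero le_rfl, hρ.eq_zero 0 le_rfl] at this
  linarith

theorem deriv_mul_le (hρ : IsProfile ρ γ s₀ κ) (s : ℝ) : deriv ρ s * s ≤ γ * |s| := by
  rcases le_total 0 s with hs | hs
  · rw [abs_of_nonneg hs]; exact mul_le_mul_of_nonneg_right (hρ.deriv_le s) hs
  · rw [hρ.deriv_eq_zero hs, zero_mul]; exact mul_nonneg hρ.gamma_pos.le (abs_nonneg _)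

theorem le_mul_abs (hρ : IsProfile ρ γ s₀ κ) (s : ℝ) : ρ s ≤ γ * |s| := by
  have h1 := hρ.tangent_le s 0
  rw [hρ.eq_zero 0 le_rfl] at h1
  linarith [hρ.deriv_mul_le s]

end IsProfile

/-! ### Pointwise estimates for the stress. -/

/-- The primitive `G(s) = s ρ'(s) - ρ(s)` of `s ρ''(s)`. -/
noncomputable def legendre (ρ : ℝ → ℝ) (s : ℝ) : ℝ := s * deriv ρ s - ρ s

/-- The tangent at `s`, evaluated at `0` where `ρ` vanishes, gives `0 ≤ legendre ρ s`; the upper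
bound uses `ρ ≥ 0`. This linear growth makes `legendre ρ (det ∇u)` integrable for `∇u ∈ L²`. -/
theorem IsProfile.abs_legendre_le {ρ : ℝ → ℝ} {γ s₀ κ : ℝ} (hρ : IsProfile ρ γ s₀ κ) (s : ℝ) :
    |legendre ρ s| ≤ γ * |s| := by
  have h1 := hρ.tangent_le s 0
  rw [hρ.eq_zero 0 le_rfl] at h1
  have h0 := hρ.nonneg s
  have h2 := hρ.deriv_mul_le s
  rw [legendre, abs_le]
  constructor <;> nlinarith [abs_nonneg s, hρ.gamma_pos]

/-- The derivative `ξ + ρ'(det ξ) cof ξ` of the integrand. -/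
noncomputable def stress (ρ : ℝ → ℝ) (ξ : Matrix (Fin 2) (Fin 2) ℝ) : Matrix (Fin 2) (Fin 2) ℝ :=
  ξ + deriv ρ ξ.det • ξ.adjugate.transpose

/-- The squared Frobenius norm. -/
def frobSq (ξ : Matrix (Fin 2) (Fin 2) ℝ) : ℝ := ∑ i, ∑ j, ξ i j ^ 2

theorem abs_det_le_frobSq (ξ : Matrix (Fin 2) (Fin 2) ℝ) : |ξ.det| ≤ frobSq ξ / 2 := by
  simp only [Matrix.det_fin_two, frobSq, Fin.sum_univ_two, abs_le]
  constructor <;> nlinarith [sq_nonneg (ξ 0 0 - ξ 1 1), sq_nonneg (ξ 0 0 + ξ 1 1),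
    sq_nonneg (ξ 0 1 - ξ 1 0), sq_nonneg (ξ 0 1 + ξ 1 0)]

theorem stress_apply_abs_le {ρ : ℝ → ℝ} {γ s₀ κ : ℝ} (hρ : IsProfile ρ γ s₀ κ) (hγ : γ < 1)
    (ξ : Matrix (Fin 2) (Fin 2) ℝ) (i j : Fin 2) : |stress ρ ξ i j| ≤ ∑ k, ∑ l, |ξ k l| := by
  have h0 := hρ.deriv_nonneg ξ.det
  have h1 := (hρ.deriv_le ξ.det).trans hγ.le
  have key : ∀ x y : ℝ, |x + deriv ρ ξ.det * y| ≤ |x| + |y| := fun x y => by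
    refine (abs_add_le _ _).trans (add_le_add le_rfl ?_)
    rw [abs_mul, abs_of_nonneg h0]
    exact mul_le_of_le_one_left (abs_nonneg _) h1
  simp only [Fin.sum_univ_two]
  have p00 := abs_nonneg (ξ 0 0); have p01 := abs_nonneg (ξ 0 1)
  have p10 := abs_nonneg (ξ 1 0); have p11 := abs_nonneg (ξ 1 1)
  fin_cases i <;> fin_cases j <;>
    simp only [stress, Matrix.adjugate_fin_two, Matrix.add_apply, Matrix.smul_apply,
      Matrix.transpose_apply, Matrix.of_apply, Matrix.cons_val', Matrix.cons_val_zero,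
      Matrix.cons_val_one, smul_eq_mul, Fin.zero_eta, Fin.mk_one, Fin.isValue,
      Matrix.cons_val_fin_one] <;>
    (refine (key _ _).trans ?_; (try rw [abs_neg]); linarith)

/-- Strong monotonicity of the stress, with the contribution of the determinant kept. -/
theorem stress_monotone {ρ : ℝ → ℝ} {γ s₀ κ : ℝ} (hρ : IsProfile ρ γ s₀ κ)
    (ξ ξ' : Matrix (Fin 2) (Fin 2) ℝ) :
    (1 - γ) * frobSq (ξ' - ξ) + (deriv ρ ξ'.det - deriv ρ ξ.det) * (ξ'.det - ξ.det)
      ≤ ∑ i, ∑ j, (stress ρ ξ' i j - stress ρ ξ i j) * (ξ' i j - ξ i j) := by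
  -- With `N = ξ' - ξ`, expanding the quadratic form `det` about either endpoint gives `cof ξ : N =
  -- det ξ' - det ξ - det N` and `cof ξ' : N = det ξ' - det ξ + det N`.
  have e : ∑ i, ∑ j, (stress ρ ξ' i j - stress ρ ξ i j) * (ξ' i j - ξ i j)
      = frobSq (ξ' - ξ) + (deriv ρ ξ.det + deriv ρ ξ'.det) * (ξ' - ξ).det
        + (deriv ρ ξ'.det - deriv ρ ξ.det) * (ξ'.det - ξ.det) := by
    unfold stress
    generalize deriv ρ ξ.det = p
    generalize deriv ρ ξ'.det = p'
    simp [frobSq, Fin.sum_univ_two, Matrix.adjugate_fin_two, Matrix.det_fin_two]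
    ring
  have h1 := (abs_le.1 (abs_det_le_frobSq (ξ' - ξ))).1
  have hp0 := hρ.deriv_nonneg ξ.det
  have hp0' := hρ.deriv_nonneg ξ'.det
  have hp1 := hρ.deriv_le ξ.det
  have hp1' := hρ.deriv_le ξ'.det
  have hF : 0 ≤ frobSq (ξ' - ξ) := by unfold frobSq; positivity
  rw [e]
  nlinarith [mul_nonneg (add_nonneg hp0 hp0') (by linarith : 0 ≤ (ξ' - ξ).det +
    frobSq (ξ' - ξ) / 2), mul_nonneg (by linarith : 0 ≤ 2 * γ - deriv ρ ξ.det - deriv ρ ξ'.det) hF]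

theorem young_mul_le {ε X y : ℝ} (hε : 0 < ε) : X * y ≤ ε * X ^ 2 + y ^ 2 / (4 * ε) := by
  have : ε * X ^ 2 + y ^ 2 / (4 * ε) - X * y = (2 * ε * X - y) ^ 2 / (4 * ε) := by
    field_simp; ring
  have h : 0 ≤ (2 * ε * X - y) ^ 2 / (4 * ε) := by positivity
  linarith

/-- In two dimensions `cof` is linear, so with `N = ξ' - ξ` the stress increment is `N + p' cof N +
(p' - p) cof ξ`, where `p = ρ'(det ξ)` and `p' = ρ'(det ξ')`. In the last part write `a = (a - h ξ
e_k) + h ξ e_k`; by `ξᵀ cof ξ = (det ξ) 1` the second summand contributes `h z_k (p' - p) det ξ`.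
This is `h z_k` times the increment of `legendre ρ` minus the gap between `ρ` at `det ξ` and its
tangent at `det ξ'`. -/
theorem stress_cross_term {ρ : ℝ → ℝ} (ξ ξ' : Matrix (Fin 2) (Fin 2) ℝ) (z a : Fin 2 → ℝ)
    (h : ℝ) (k : Fin 2) :
    ∑ i, ∑ j, (stress ρ ξ' i j - stress ρ ξ i j) * (z j * a i)
      = (∑ i, ∑ j, ((ξ' - ξ) i j + deriv ρ ξ'.det * (ξ' - ξ).adjugate j i) * (z j * a i))
        + (deriv ρ ξ'.det - deriv ρ ξ.det)
          * (∑ i, ∑ j, ξ.adjugate j i * z j * (a i - h * ξ i k))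
        + h * z k * (legendre ρ ξ'.det - legendre ρ ξ.det)
        - h * z k * (ρ ξ.det - ρ ξ'.det - deriv ρ ξ'.det * (ξ.det - ξ'.det)) := by
  unfold legendre stress
  generalize deriv ρ ξ.det = p
  generalize deriv ρ ξ'.det = p'
  generalize ρ ξ.det = r
  generalize ρ ξ'.det = r'
  fin_cases k <;>
  · simp [Fin.sum_univ_two, Matrix.adjugate_fin_two, Matrix.det_fin_two]
    ring

/-- Intended for `z = ∇(η²)` and `a` the increment of `u`. No Lipschitz bound on the stress enters:
half of the coercivity absorbs the terms linear in `ξ' - ξ`, and the monotone determinant term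
absorbs the convexity defect. The increment of `legendre ρ` is kept exact because it is small only
after integration. -/
theorem stress_difference_estimate {ρ : ℝ → ℝ} {γ s₀ κ : ℝ} (hρ : IsProfile ρ γ s₀ κ)
    (hγ : γ < 1) (ξ ξ' : Matrix (Fin 2) (Fin 2) ℝ) (z a : Fin 2 → ℝ) {η L h : ℝ} (hη : 0 ≤ η)
    (hz : ∀ j, |z j| ≤ L * η) (hh : 0 ≤ h) (k : Fin 2) :
    (1 - γ) / 2 * (η ^ 2 * frobSq (ξ' - ξ))
      ≤ (∑ i, ∑ j, (stress ρ ξ' i j - stress ρ ξ i j) * (η ^ 2 * (ξ' i j - ξ i j) + z j * a i))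
        - h * z k * (legendre ρ ξ'.det - legendre ρ ξ.det)
        + 4 * L ^ 2 / (1 - γ) * (∑ i, a i ^ 2)
        + L * (∑ i, ∑ j, |ξ i j|) * (∑ i, |η * (a i - h * ξ i k)|)
        + h ^ 2 * L ^ 2 * (frobSq ξ + frobSq ξ') := by
  have hγ0 : 0 < 1 - γ := by linarith
  have hsplit : ∑ i, ∑ j, (stress ρ ξ' i j - stress ρ ξ i j) * (η ^ 2 * (ξ' i j - ξ i j) + z j * a i)
      = η ^ 2 * (∑ i, ∑ j, (stress ρ ξ' i j - stress ρ ξ i j) * (ξ' i j - ξ i j))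
        + ∑ i, ∑ j, (stress ρ ξ' i j - stress ρ ξ i j) * (z j * a i) := by
    simp only [Fin.sum_univ_two]; ring
  rw [hsplit, stress_cross_term ξ ξ' z a h k]
  have hmono := mul_le_mul_of_nonneg_left (stress_monotone hρ ξ ξ') (sq_nonneg η)
  set p := deriv ρ ξ.det with hp
  set p' := deriv ρ ξ'.det with hp'
  set d := ξ.det with hd
  set d' := ξ'.det with hd'
  have hp0 : 0 ≤ p := hρ.deriv_nonneg d
  have hp0' : 0 ≤ p' := hρ.deriv_nonneg d'
  have hp1 : p ≤ 1 := (hρ.deriv_le d).trans hγ.le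
  have hp1' : p' ≤ 1 := (hρ.deriv_le d').trans hγ.le
  have hdp : |p' - p| ≤ 1 := abs_le.2 ⟨by linarith, by linarith⟩
  -- the terms linear in the increment of the gradient
  have hlin : -((1 - γ) / 2 * (η ^ 2 * frobSq (ξ' - ξ))) - 4 * L ^ 2 / (1 - γ) * (∑ i, a i ^ 2)
      ≤ ∑ i, ∑ j, ((ξ' - ξ) i j + p' * (ξ' - ξ).adjugate j i) * (z j * a i) := by
    have h1 : ∀ (X : ℝ) (i j : Fin 2), -((1 - γ) / 8 * (η ^ 2 * X ^ 2)) -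
        2 * L ^ 2 / (1 - γ) * a i ^ 2 ≤ X * (z j * a i) := by
      intro X i j
      -- The four squared factors sum to at most `4 |ξ' - ξ|²`, so the weight `(1 - γ)/8` spends
      -- exactly half of `1 - γ`.
      have h2 := young_mul_le (ε := (1 - γ) / 8) (X := η * |X|) (y := L * |a i|) (by linarith)
      have h3 : |X * (z j * a i)| ≤ η * |X| * (L * |a i|) := by
        rw [abs_mul, abs_mul]
        nlinarith [mul_le_mul_of_nonneg_right (hz j) (mul_nonneg (abs_nonneg X) (abs_nonneg (a i)))]
      have h4 : (L * |a i|) ^ 2 / (4 * ((1 - γ) / 8)) = 2 * L ^ 2 / (1 - γ) * a i ^ 2 := by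
        rw [mul_pow, sq_abs]; field_simp; ring
      rw [h4, mul_pow, sq_abs] at h2
      have := (abs_le.1 h3).1
      linarith
    have hs := Finset.sum_le_sum fun i (_ : i ∈ (Finset.univ : Finset (Fin 2))) =>
      Finset.sum_le_sum fun j (_ : j ∈ (Finset.univ : Finset (Fin 2))) =>
        h1 ((ξ' - ξ) i j + p' * (ξ' - ξ).adjugate j i) i j
    refine le_trans ?_ hs
    have hX : ∑ i, ∑ j, ((ξ' - ξ) i j + p' * (ξ' - ξ).adjugate j i) ^ 2 ≤ 4 * frobSq (ξ' - ξ) := by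
      have h5 : ∀ x y : ℝ, (x + p' * y) ^ 2 ≤ 2 * x ^ 2 + 2 * y ^ 2 := fun x y => by
        have h6 : (p' * y) ^ 2 ≤ y ^ 2 := by
          rw [mul_pow]; exact mul_le_of_le_one_left (sq_nonneg _) (by nlinarith)
        nlinarith [sq_nonneg (x - p' * y)]
      simp only [frobSq, Fin.sum_univ_two, Matrix.adjugate_fin_two, Matrix.of_apply,
        Matrix.cons_val', Matrix.cons_val_zero, Matrix.cons_val_one, Matrix.cons_val_fin_one]
      have q00 := h5 ((ξ' - ξ) 0 0) ((ξ' - ξ) 1 1)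
      have q01 := h5 ((ξ' - ξ) 0 1) (-(ξ' - ξ) 1 0)
      have q10 := h5 ((ξ' - ξ) 1 0) (-(ξ' - ξ) 0 1)
      have q11 := h5 ((ξ' - ξ) 1 1) ((ξ' - ξ) 0 0)
      simp only [neg_sq] at q01 q10
      linarith
    have hX' := mul_le_mul_of_nonneg_left hX (by positivity : 0 ≤ (1 - γ) / 8 * η ^ 2)
    have e1 : ∑ i, ∑ j, (-((1 - γ) / 8 * (η ^ 2 * ((ξ' - ξ) i j
          + p' * (ξ' - ξ).adjugate j i) ^ 2)) - 2 * L ^ 2 / (1 - γ) * a i ^ 2)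
        = -((1 - γ) / 8 * η ^ 2 * ∑ i, ∑ j, ((ξ' - ξ) i j + p' * (ξ' - ξ).adjugate j i) ^ 2)
          - 4 * L ^ 2 / (1 - γ) * (∑ i, a i ^ 2) := by
      simp only [Fin.sum_univ_two]; ring
    rw [e1]
    linarith
  -- the terms containing the Taylor remainder
  have hrem : -(L * (∑ i, ∑ j, |ξ i j|) * (∑ i, |η * (a i - h * ξ i k)|))
      ≤ (p' - p) * (∑ i, ∑ j, ξ.adjugate j i * z j * (a i - h * ξ i k)) := by
    refine (abs_le.1 ?_).1
    rw [abs_mul]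
    refine (mul_le_of_le_one_left (abs_nonneg _) hdp).trans ?_
    have t : ∀ (c : ℝ) (i j : Fin 2), |c * z j * (a i - h * ξ i k)|
        ≤ L * |c| * |η * (a i - h * ξ i k)| := fun c i j => by
      rw [abs_mul, abs_mul, abs_mul, abs_of_nonneg hη]
      nlinarith [mul_le_mul_of_nonneg_right (hz j)
        (mul_nonneg (abs_nonneg c) (abs_nonneg (a i - h * ξ i k)))]
    simp only [Fin.sum_univ_two, Matrix.adjugate_fin_two, Matrix.of_apply,
        Matrix.cons_val', Matrix.cons_val_zero, Matrix.cons_val_one, Matrix.cons_val_fin_one]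
    have q00 := t (ξ 1 1) 0 0
    have q01 := t (-ξ 1 0) 0 1
    have q10 := t (-ξ 0 1) 1 0
    have q11 := t (ξ 0 0) 1 1
    simp only [abs_neg] at q01 q10
    -- The bound on `z` forces `L ≥ 0` only where `η > 0`; elsewhere the products vanish.
    have hL : 0 ≤ L ∨ η = 0 := by
      rcases hη.eq_or_lt with h0 | h0
      · exact Or.inr h0.symm
      · left
        have := (abs_nonneg _).trans (hz 0)
        exact nonneg_of_mul_nonneg_left this h0
    have hpos : ∀ (c : ℝ) (i : Fin 2), 0 ≤ L * |c| * |η * (a i - h * ξ i k)| := fun c i => by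
      rcases hL with h0 | h0
      · positivity
      · simp [h0]
    have n00 := hpos (ξ 0 0) 0
    have n01 := hpos (ξ 0 1) 0
    have n10 := hpos (ξ 1 0) 1
    have n11 := hpos (ξ 1 1) 1
    refine (abs_add_le _ _).trans ?_
    have b1 := abs_add_le (ξ 1 1 * z 0 * (a 0 - h * ξ 0 k)) (-ξ 1 0 * z 1 * (a 0 - h * ξ 0 k))
    have b2 := abs_add_le (-ξ 0 1 * z 0 * (a 1 - h * ξ 1 k)) (ξ 0 0 * z 1 * (a 1 - h * ξ 1 k))
    linarith
  -- the convexity defect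
  have hdef : -(η ^ 2 * ((p' - p) * (d' - d))) - h ^ 2 * L ^ 2 * (frobSq ξ + frobSq ξ')
      ≤ -(h * z k * (ρ d - ρ d' - p' * (d - d'))) := by
    have hR0 : 0 ≤ ρ d - ρ d' - p' * (d - d') := by linarith [hρ.tangent_le d' d]
    -- The defect `R` and the defect with `d` and `d'` exchanged are both nonnegative and sum to
    -- `(p' - p)(d' - d)`.
    have hR1 : ρ d - ρ d' - p' * (d - d') ≤ (p' - p) * (d' - d) := by
      linarith [hρ.tangent_le d d']
    set R := ρ d - ρ d' - p' * (d - d')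
    set S := (p' - p) * (d' - d)
    have hS : S ≤ (frobSq ξ + frobSq ξ') / 2 := by
      have : |S| ≤ |d'| + |d| := by
        rw [abs_mul]
        exact (mul_le_of_le_one_left (abs_nonneg _) hdp).trans (abs_sub _ _)
      linarith [le_abs_self S, abs_det_le_frobSq ξ, abs_det_le_frobSq ξ']
    have h1 : h * z k * R ≤ h * (L * η) * S := by
      have h2 : z k * R ≤ L * η * S :=
        (mul_le_mul_of_nonneg_right ((le_abs_self _).trans (hz k)) hR0).trans
          (mul_le_mul_of_nonneg_left hR1 ((abs_nonneg _).trans (hz k)))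
      nlinarith [mul_le_mul_of_nonneg_left h2 hh]
    -- The part with factor `η²` is absorbed by the monotone term kept in `stress_monotone`; the
    -- rest is of order `h²`.
    have h3 : h * (L * η) ≤ η ^ 2 + h ^ 2 * L ^ 2 := by
      nlinarith [sq_nonneg (η - h * L), sq_nonneg η, sq_nonneg (h * L)]
    have h4 := mul_le_mul_of_nonneg_right h3 (hR0.trans hR1)
    have h5 := mul_le_mul_of_nonneg_left hS (by positivity : 0 ≤ h ^ 2 * L ^ 2)
    have h6 : 0 ≤ h ^ 2 * L ^ 2 * (frobSq ξ + frobSq ξ') := by unfold frobSq; positivity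
    linarith
  linarith

/-! ### Weak solutions and the differenced equation. -/

/-- The pair `(u, G)` of square integrable functions on the plane satisfies `∇u = G` and
`div (stress ρ G) = 0` weakly in `Ω`. -/
structure IsWeakSolution (ρ : ℝ → ℝ) (Ω : Set Plane) (u : Fin 2 → Plane → ℝ)
    (G : Plane → Matrix (Fin 2) (Fin 2) ℝ) : Prop where
  memLp : ∀ i, MemLp (u i) 2 volume
  memLp_grad : ∀ i j, MemLp (fun x => G x i j) 2 volume
  weak : ∀ i j, ∀ φ : Plane → ℝ, IsTestFunction Ω φ →
    ∫ x, fderiv ℝ φ x (unitVec j) * u i x = -∫ x, φ x * G x i j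
  euler : ∀ φ : Fin 2 → Plane → ℝ, (∀ i, IsTestFunction Ω (φ i)) →
    ∫ x, ∑ i, ∑ j, stress ρ (G x) i j * fderiv ℝ (φ i) x (unitVec j) = 0

theorem aestronglyMeasurable_det {X : Type*} [MeasurableSpace X] {μ : Measure X}
    {G : X → Matrix (Fin 2) (Fin 2) ℝ} (hG : ∀ i j, AEStronglyMeasurable (fun x => G x i j) μ) :
    AEStronglyMeasurable (fun x => (G x).det) μ := by
  simp only [Matrix.det_fin_two]
  exact ((hG 0 0).mul (hG 1 1)).sub ((hG 0 1).mul (hG 1 0))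

theorem IsProfile.aestronglyMeasurable_stress {ρ : ℝ → ℝ} {γ s₀ κ : ℝ} (hρ : IsProfile ρ γ s₀ κ)
    {X : Type*} [MeasurableSpace X] {μ : Measure X}
    {G : X → Matrix (Fin 2) (Fin 2) ℝ} (hG : ∀ i j, AEStronglyMeasurable (fun x => G x i j) μ)
    (i j : Fin 2) : AEStronglyMeasurable (fun x => stress ρ (G x) i j) μ := by
  have hadj : AEStronglyMeasurable (fun x => (G x).adjugate j i) μ := by
    fin_cases i <;> fin_cases j <;>
      simp only [Matrix.adjugate_fin_two, Matrix.of_apply, Matrix.cons_val',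
        Matrix.cons_val_zero, Matrix.cons_val_one, Matrix.cons_val_fin_one, Fin.zero_eta,
        Fin.mk_one, Fin.isValue] <;>
      first | exact hG _ _ | exact (hG _ _).neg
  simp only [stress, Matrix.add_apply, Matrix.smul_apply, Matrix.transpose_apply, smul_eq_mul]
  exact (hG i j).add
    ((hρ.continuous_deriv.comp_aestronglyMeasurable (aestronglyMeasurable_det hG)).mul hadj)

theorem IsProfile.memLp_stress {ρ : ℝ → ℝ} {γ s₀ κ : ℝ} (hρ : IsProfile ρ γ s₀ κ) (hγ : γ < 1)
    {X : Type*} [MeasurableSpace X] {μ : Measure X}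
    {G : X → Matrix (Fin 2) (Fin 2) ℝ} (hG : ∀ i j, MemLp (fun x => G x i j) 2 μ)
    (i j : Fin 2) : MemLp (fun x => stress ρ (G x) i j) 2 μ := by
  have h1 : MemLp (fun x => ∑ k, ∑ l, |G x k l|) 2 μ :=
    memLp_finsetSum _ fun k _ => memLp_finsetSum _ fun l _ => (hG k l).abs
  refine h1.mono (hρ.aestronglyMeasurable_stress (fun i j => (hG i j).1) i j)
    (Eventually.of_forall fun x => ?_)
  rw [Real.norm_eq_abs, Real.norm_eq_abs]
  exact (stress_apply_abs_le hρ hγ _ i j).trans (le_abs_self _)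

theorem IsTestFunction.mul_smooth {Ω : Set Plane} {η w : Plane → ℝ} (hη : IsTestFunction Ω η)
    (hw : ContDiff ℝ ∞ w) : IsTestFunction Ω (fun x => η x * w x) where
  smooth := hη.smooth.mul hw
  compact := hη.compact.mul_right
  support_subset := (tsupport_mul_subset_left).trans hη.support_subset

theorem IsTestFunction.continuous_fderiv_apply {Ω : Set Plane} {η : Plane → ℝ}
    (hη : IsTestFunction Ω η) (y : Plane) : Continuous fun x => fderiv ℝ η x y :=
  hη.smooth.continuous_fderiv_plane_apply y

theorem IsTestFunction.hasCompactSupport_fderiv_apply {Ω : Set Plane} {η : Plane → ℝ}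
    (hη : IsTestFunction Ω η) (y : Plane) : HasCompactSupport fun x => fderiv ℝ η x y :=
  hη.compact.fderiv_apply ℝ y

theorem IsTestFunction.memLp_fderiv_apply {Ω : Set Plane} {η : Plane → ℝ}
    (hη : IsTestFunction Ω η) (y : Plane) (p : ℝ≥0∞) (μ : Measure Plane)
    [IsFiniteMeasureOnCompacts μ] : MemLp (fun x => fderiv ℝ η x y) p μ :=
  (hη.continuous_fderiv_apply y).memLp_of_hasCompactSupport (hη.hasCompactSupport_fderiv_apply y)

theorem IsTestFunction.memLp {Ω : Set Plane} {η : Plane → ℝ}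
    (hη : IsTestFunction Ω η) (p : ℝ≥0∞) (μ : Measure Plane)
    [IsFiniteMeasureOnCompacts μ] : MemLp η p μ :=
  hη.smooth.continuous.memLp_of_hasCompactSupport hη.compact

theorem IsTestFunction.sub {F : Type*} [NormedAddCommGroup F] [NormedSpace ℝ F] {Ω : Set Plane}
    {φ ψ : Plane → F} (hφ : IsTestFunction Ω φ)
    (hψ : IsTestFunction Ω ψ) : IsTestFunction Ω (fun x => φ x - ψ x) where
  smooth := hφ.smooth.sub hψ.smooth
  compact := hφ.compact.sub hψ.compact
  support_subset := (tsupport_sub φ ψ).trans (union_subset hφ.support_subset hψ.support_subset)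

theorem IsTestFunction.translate {F : Type*} [NormedAddCommGroup F] [NormedSpace ℝ F]
    {Ω Ω' : Set Plane} {φ : Plane → F} (hφ : IsTestFunction Ω φ)
    (y : Plane) (hy : ∀ x ∈ tsupport φ, x + y ∈ Ω') : IsTestFunction Ω' (fun x => φ (x - y)) := by
  have hs : tsupport (fun x => φ (x - y)) ⊆ (fun x => x + y) '' tsupport φ := by
    refine closure_minimal (fun x hx => ⟨x - y, subset_tsupport _ hx, by simp⟩) ?_
    exact (Homeomorph.addRight y).isClosedMap _ (isClosed_tsupport _)
  refine ⟨hφ.smooth.comp (contDiff_id.sub contDiff_const), ?_, ?_⟩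
  · exact HasCompactSupport.of_support_subset_isCompact
      (hφ.compact.isCompact.image (continuous_add_const y)) ((subset_tsupport _).trans hs)
  · rintro x hx
    obtain ⟨a, ha, rfl⟩ := hs hx
    exact hy a ha

theorem fderiv_comp_sub_const {v : Plane → ℝ} (x y : Plane) :
    fderiv ℝ (fun x => v (x - y)) x = fderiv ℝ v (x - y) := by
  simp [sub_eq_add_neg, fderiv_comp_add_right]

theorem integral_sum_sum {X : Type*} [MeasurableSpace X] {μ : Measure X}
    {f : Fin 2 → Fin 2 → X → ℝ} (hf : ∀ i j, Integrable (f i j) μ) :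
    ∫ x, ∑ i, ∑ j, f i j x ∂μ = ∑ i, ∑ j, ∫ x, f i j x ∂μ := by
  rw [integral_finsetSum _ fun i _ => integrable_finsetSum _ fun j _ => hf i j]
  exact Finset.sum_congr rfl fun i _ => integral_finsetSum _ fun j _ => hf i j

/-- Test the equation with `v(x - y) - v(x)` and translate the first half. The hypothesis on `y`
keeps the translated test function supported in `Ω`. -/
theorem IsWeakSolution.difference_test {ρ : ℝ → ℝ} {γ s₀ κ : ℝ} (hρ : IsProfile ρ γ s₀ κ)
    (hγ : γ < 1) {Ω : Set Plane} {u : Fin 2 → Plane → ℝ} {G : Plane → Matrix (Fin 2) (Fin 2) ℝ}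
    (hu : IsWeakSolution ρ Ω u G) {v : Fin 2 → Plane → ℝ} (hv : ∀ i, IsTestFunction Ω (v i))
    {y : Plane} (hy : ∀ i, ∀ x ∈ tsupport (v i), x + y ∈ Ω) :
    ∫ x, ∑ i, ∑ j, (stress ρ (G (x + y)) i j - stress ρ (G x) i j)
      * fderiv ℝ (v i) x (unitVec j) = 0 := by
  have hA := fun i j => hρ.memLp_stress hγ hu.memLp_grad i j
  have hA' : ∀ i j, MemLp (fun x => stress ρ (G (x + y)) i j) 2 volume := fun i j =>
    (hA i j).comp_add_right_plane y
  have hV := fun i j => (hv i).memLp_fderiv_apply (unitVec j) 2 volume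
  have hV' : ∀ i j, MemLp (fun x => fderiv ℝ (v i) (x - y) (unitVec j)) 2 volume := fun i j => by
    simpa [sub_eq_add_neg] using (hV i j).comp_add_right_plane (-y)
  have h0 := hu.euler (fun i x => v i (x - y) - v i x) fun i =>
    ((hv i).translate y (hy i)).sub (hv i)
  have hfd : ∀ i x j, fderiv ℝ (fun x => v i (x - y) - v i x) x (unitVec j)
      = fderiv ℝ (v i) (x - y) (unitVec j) - fderiv ℝ (v i) x (unitVec j) := fun i x j => by
    have hd := (hv i).smooth.differentiable (by simp)
    rw [fderiv_fun_sub, fderiv_comp_sub_const]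
    · rfl
    · exact (hd.comp (differentiable_id.sub_const y)) x
    · exact hd x
  have i1 : ∀ i j, Integrable (fun x => stress ρ (G x) i j * fderiv ℝ (v i) (x - y) (unitVec j))
    volume := fun i j => (hA i j).integrable_mul (hV' i j)
  have i2 : ∀ i j, Integrable (fun x => stress ρ (G x) i j * fderiv ℝ (v i) x (unitVec j))
    volume := fun i j => (hA i j).integrable_mul (hV i j)
  have i3 : ∀ i j, Integrable (fun x => stress ρ (G (x + y)) i j * fderiv ℝ (v i) x (unitVec j))
    volume := fun i j => (hA' i j).integrable_mul (hV i j)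
  simp only [hfd, mul_sub] at h0
  replace h0 := (integral_sum_sum fun i j => (i1 i j).sub (i2 i j)).symm.trans h0
  simp only [sub_mul]
  refine (integral_sum_sum fun i j => (i3 i j).sub (i2 i j)).trans ?_
  rw [← h0]
  refine Finset.sum_congr rfl fun i _ => Finset.sum_congr rfl fun j _ => ?_
  have e := integral_add_right_eq_self (μ := (volume : Measure Plane))
    (fun x => stress ρ (G x) i j * fderiv ℝ (v i) (x - y) (unitVec j)) y
  simp only [add_sub_cancel_right] at e
  exact (integral_sub (i3 i j) (i2 i j)).trans
    (((integral_sub (i1 i j) (i2 i j)).trans (by rw [e])).symm)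

theorem tendsto_integral_mul_of_eLpNorm {X : Type*} [MeasurableSpace X] {μ : Measure X}
    {F H : X → ℝ} {Hn : ℕ → X → ℝ} (hF : MemLp F 2 μ) (hH : MemLp H 2 μ)
    (hHn : ∀ n, MemLp (Hn n) 2 μ) (hlim : Tendsto (fun n => eLpNorm (Hn n - H) 2 μ) atTop (𝓝 0)) :
    Tendsto (fun n => ∫ x, F x * Hn n x ∂μ) atTop (𝓝 (∫ x, F x * H x ∂μ)) := by
  refine tendsto_integral_of_L1' _ (hF.integrable_mul hH).aestronglyMeasurable
    (Eventually.of_forall fun n => hF.integrable_mul (hHn n)) ?_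
  have hb : ∀ n, eLpNorm ((fun x => F x * Hn n x) - fun x => F x * H x) 1 μ
      ≤ eLpNorm F 2 μ * eLpNorm (Hn n - H) 2 μ := fun n => by
    have e : ((fun x => F x * Hn n x) - fun x => F x * H x) = F • (Hn n - H) := by
      ext x; simp [mul_sub]
    rw [e]
    exact eLpNorm_smul_le_mul_eLpNorm ((hHn n).1.sub hH.1) hF.1
  refine tendsto_of_tendsto_of_tendsto_of_le_of_le tendsto_const_nhds ?_ (fun _ => zero_le) hb
  have := ENNReal.Tendsto.const_mul hlim (Or.inr hF.2.ne) (a := eLpNorm F 2 μ)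
  simpa using this

theorem tendsto_eLpNorm_mul_translate {ψ : Plane → ℝ} {w : ℕ → Plane → ℝ} {K' : Set Plane}
    (hK' : MeasurableSet K') {C : ℝ} (hψC : ∀ x, |ψ x| ≤ C) {y : Plane}
    (hψ0 : ∀ x, ψ x ≠ 0 → x + y ∈ K') (hw : ∀ n, AEStronglyMeasurable (w n) volume)
    (hlim : Tendsto (fun n => eLpNorm (w n) 2 (volume.restrict K')) atTop (𝓝 0)) :
    Tendsto (fun n => eLpNorm (fun x => ψ x * w n (x + y)) 2 volume) atTop (𝓝 0) := by
  have hC : 0 < C + 1 := by linarith [(abs_nonneg _).trans (hψC 0)]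
  have h1 : ∀ n, eLpNorm (fun x => ψ x * w n (x + y)) 2 volume
      ≤ ENNReal.ofReal (C + 1) * eLpNorm (w n) 2 (volume.restrict K') := fun n => by
    have h2 := eLpNorm_mul_translate_le (ψ := fun x => ψ x / (C + 1)) hK' (fun x => by
      rw [abs_div, abs_of_pos hC, div_le_one hC]; linarith [hψC x]) (y := y)
      (fun x hx => hψ0 x fun h => hx (by simp [h])) (hw n)
    have e : (fun x => ψ x * w n (x + y))
        = (C + 1) • fun x => ψ x / (C + 1) * w n (x + y) := by
      ext x; simp; field_simp
    rw [e, eLpNorm_const_smul, Real.enorm_eq_ofReal hC.le]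
    gcongr
  refine tendsto_of_tendsto_of_tendsto_of_le_of_le tendsto_const_nhds ?_ (fun _ => zero_le) h1
  simpa using ENNReal.Tendsto.const_mul hlim (Or.inr ENNReal.ofReal_ne_top)
    (a := ENNReal.ofReal (C + 1))

theorem IsTestFunction.sq {Ω : Set Plane} {η : Plane → ℝ} (hη : IsTestFunction Ω η) :
    IsTestFunction Ω (fun x => η x ^ 2) := by
  simpa only [pow_two] using hη.mul_smooth hη.smooth

theorem IsTestFunction.exists_abs_le {Ω : Set Plane} {η : Plane → ℝ} (hη : IsTestFunction Ω η) :
    ∃ C, ∀ x, |η x| ≤ C := by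
  obtain ⟨C, hC⟩ := hη.compact.exists_bound_of_continuous hη.smooth.continuous
  exact ⟨C, hC⟩

theorem IsTestFunction.fderiv_apply {Ω : Set Plane} {η : Plane → ℝ} (hη : IsTestFunction Ω η)
    (y : Plane) : IsTestFunction Ω (fun x => fderiv ℝ η x y) where
  smooth := (hη.smooth.fderiv_right (by simp)).clm_apply contDiff_const
  compact := hη.hasCompactSupport_fderiv_apply y
  support_subset := (tsupport_fderiv_apply_subset ℝ y).trans hη.support_subset

theorem IsTestFunction.memLp_mul {Ω : Set Plane} {η f : Plane → ℝ} (hη : IsTestFunction Ω η)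
    {p : ℝ≥0∞} {μ : Measure Plane} [IsFiniteMeasureOnCompacts μ] (hf : MemLp f p μ) :
    MemLp (fun x => η x * f x) p μ :=
  MemLp.mul (r := p) (p := ∞) (q := p) hf (hη.memLp ∞ μ)

theorem tendsto_eLpNorm_add {X : Type*} [MeasurableSpace X] {μ : Measure X} {f g : ℕ → X → ℝ}
    (hf : ∀ n, AEStronglyMeasurable (f n) μ) (hg : ∀ n, AEStronglyMeasurable (g n) μ)
    (hf0 : Tendsto (fun n => eLpNorm (f n) 2 μ) atTop (𝓝 0))
    (hg0 : Tendsto (fun n => eLpNorm (g n) 2 μ) atTop (𝓝 0)) :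
    Tendsto (fun n => eLpNorm (f n + g n) 2 μ) atTop (𝓝 0) := by
  refine tendsto_of_tendsto_of_tendsto_of_le_of_le tendsto_const_nhds ?_ (fun _ => zero_le)
    fun n => eLpNorm_add_le (hf n) (hg n) (by norm_num)
  simpa using hf0.add hg0

theorem tendsto_eLpNorm_sub {X : Type*} [MeasurableSpace X] {μ : Measure X} {f g : ℕ → X → ℝ}
    (hf : ∀ n, AEStronglyMeasurable (f n) μ) (hg : ∀ n, AEStronglyMeasurable (g n) μ)
    (hf0 : Tendsto (fun n => eLpNorm (f n) 2 μ) atTop (𝓝 0))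
    (hg0 : Tendsto (fun n => eLpNorm (g n) 2 μ) atTop (𝓝 0)) :
    Tendsto (fun n => eLpNorm (f n - g n) 2 μ) atTop (𝓝 0) := by
  refine tendsto_of_tendsto_of_tendsto_of_le_of_le tendsto_const_nhds ?_ (fun _ => zero_le)
    fun n => eLpNorm_sub_le (hf n) (hg n) (by norm_num)
  simpa using hf0.add hg0

/-- The differenced equation tested with `η²` times the difference of the solution. -/
theorem IsWeakSolution.cutoff_identity {ρ : ℝ → ℝ} {γ s₀ κ : ℝ} (hρ : IsProfile ρ γ s₀ κ)
    (hγ : γ < 1) {Ω : Set Plane} (hΩ : IsOpen Ω) {u : Fin 2 → Plane → ℝ}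
    {G : Plane → Matrix (Fin 2) (Fin 2) ℝ}
    (hu : IsWeakSolution ρ Ω u G) {η : Plane → ℝ} (hη : IsTestFunction Ω η) {K' : Set Plane}
    (hK' : IsCompact K') (hK'Ω : K' ⊆ Ω) {y : Plane} (hηK : tsupport η ⊆ K')
    (hηy : ∀ x ∈ tsupport η, x + y ∈ K') :
    ∫ x, ∑ i, ∑ j, (stress ρ (G (x + y)) i j - stress ρ (G x) i j)
      * (η x ^ 2 * (G (x + y) i j - G x i j)
        + fderiv ℝ (fun x => η x ^ 2) x (unitVec j) * (u i (x + y) - u i x)) = 0 := by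
  -- The function `η² (u(x + y) - u(x))` need not be smooth, so `u` is replaced by smooth
  -- approximations on `K'`, which contains both the support of `η` and its translate.
  choose v hv hva hvb using fun i =>
    exists_smooth_approx (hu.memLp i) (hu.memLp_grad i) hΩ hK' hK'Ω (hu.weak i)
  have hζ := hη.sq
  have hζη : tsupport (fun x => η x ^ 2) ⊆ tsupport η :=
    closure_mono fun x hx => by
      simp only [Function.mem_support] at hx ⊢
      exact fun h => hx (by simp [h])
  have hW : ∀ i n, ContDiff ℝ ∞ (fun x => v i n (x + y) - v i n x) := fun i n =>
    ((hv i n).comp (contDiff_id.add contDiff_const)).sub (hv i n)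
  have hV : ∀ i n, IsTestFunction Ω (fun x => η x ^ 2 * (v i n (x + y) - v i n x)) := fun i n =>
    hζ.mul_smooth (hW i n)
  have hVsub : ∀ i n, tsupport (fun x => η x ^ 2 * (v i n (x + y) - v i n x)) ⊆ tsupport η :=
    fun i n => tsupport_mul_subset_left.trans hζη
  have hzero : ∀ n, ∫ x, ∑ i, ∑ j, (stress ρ (G (x + y)) i j - stress ρ (G x) i j)
      * fderiv ℝ (fun x => η x ^ 2 * (v i n (x + y) - v i n x)) x (unitVec j) = 0 := fun n =>
    hu.difference_test hρ hγ (fun i => hV i n) fun i x hx => hK'Ω (hηy x (hVsub i n hx))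
  have hfd : ∀ i n j x, fderiv ℝ (fun x => η x ^ 2 * (v i n (x + y) - v i n x)) x (unitVec j)
      = η x ^ 2 * (fderiv ℝ (v i n) (x + y) (unitVec j) - fderiv ℝ (v i n) x (unitVec j))
        + fderiv ℝ (fun x => η x ^ 2) x (unitVec j) * (v i n (x + y) - v i n x) := by
    intro i n j x
    have hd := (hv i n).differentiable (by simp)
    rw [fderiv_fun_mul (hζ.smooth.differentiable (by simp) x)
      ((hW i n).differentiable (by simp) x), fderiv_fun_sub _ (hd x), fderiv_comp_add_right]
    · simp [mul_comm]
    · exact (hd.comp (differentiable_id.add_const y)) x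
  have hA : ∀ i j, MemLp (fun x => stress ρ (G (x + y)) i j - stress ρ (G x) i j) 2 volume :=
    fun i j => ((hρ.memLp_stress hγ hu.memLp_grad i j).comp_add_right_plane y).sub
      (hρ.memLp_stress hγ hu.memLp_grad i j)
  have hH : ∀ i j, MemLp (fun x => η x ^ 2 * (G (x + y) i j - G x i j)
        + fderiv ℝ (fun x => η x ^ 2) x (unitVec j) * (u i (x + y) - u i x)) 2 volume :=
    fun i j => (hζ.memLp_mul (((hu.memLp_grad i j).comp_add_right_plane y).sub
      (hu.memLp_grad i j))).add ((hζ.fderiv_apply (unitVec j)).memLp_mul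
        (((hu.memLp i).comp_add_right_plane y).sub (hu.memLp i)))
  have hHn := fun i j n => (hV i n).memLp_fderiv_apply (unitVec j) 2 volume
  have hlim : ∀ i j, Tendsto (fun n => ∫ x, (stress ρ (G (x + y)) i j - stress ρ (G x) i j)
      * fderiv ℝ (fun x => η x ^ 2 * (v i n (x + y) - v i n x)) x (unitVec j)) atTop
      (𝓝 (∫ x, (stress ρ (G (x + y)) i j - stress ρ (G x) i j)
      * (η x ^ 2 * (G (x + y) i j - G x i j)
        + fderiv ℝ (fun x => η x ^ 2) x (unitVec j) * (u i (x + y) - u i x)))) := by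
    intro i j
    -- The stress increment is a fixed `L²` function, so `L²` convergence of the test gradients
    -- suffices.
    refine tendsto_integral_mul_of_eLpNorm (hA i j) (hH i j) (hHn i j) ?_
    have key : ∀ {ψ : Plane → ℝ} {w : ℕ → Plane → ℝ}, IsTestFunction Ω ψ →
        tsupport ψ ⊆ tsupport η → (∀ n, AEStronglyMeasurable (w n) volume) →
        Tendsto (fun n => eLpNorm (w n) 2 (volume.restrict K')) atTop (𝓝 0) →
        (∀ n, AEStronglyMeasurable
          ((fun x => ψ x * w n (x + y)) - fun x => ψ x * w n x) volume) ∧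
        Tendsto (fun n => eLpNorm ((fun x => ψ x * w n (x + y)) - fun x => ψ x * w n x) 2 volume)
          atTop (𝓝 0) := by
      intro ψ w hψ hψη hw hw0
      obtain ⟨C, hC⟩ := hψ.exists_abs_le
      have m1 : ∀ n, AEStronglyMeasurable (fun x => ψ x * w n (x + y)) volume := fun n =>
        hψ.smooth.continuous.aestronglyMeasurable.mul
          ((hw n).comp_measurePreserving (measurePreserving_add_right volume y))
      have m2 : ∀ n, AEStronglyMeasurable (fun x => ψ x * w n x) volume := fun n =>
        hψ.smooth.continuous.aestronglyMeasurable.mul (hw n)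
      have t2 := tendsto_eLpNorm_mul_translate hK'.measurableSet hC (y := 0)
        (fun x hx => by simpa using hηK (hψη (subset_tsupport _ hx))) hw hw0
      simp only [add_zero] at t2
      exact ⟨fun n => (m1 n).sub (m2 n), tendsto_eLpNorm_sub m1 m2
        (tendsto_eLpNorm_mul_translate hK'.measurableSet hC
          (fun x hx => hηy x (hψη (subset_tsupport _ hx))) hw hw0) t2⟩
    obtain ⟨a1, a2⟩ := key hζ hζη (w := fun n => (fun x => fderiv ℝ (v i n) x (unitVec j))
        - fun x => G x i j)
      (fun n => ((hv i n).continuous_fderiv_plane_apply _).aestronglyMeasurable.sub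
        (hu.memLp_grad i j).1) (hvb i j)
    obtain ⟨b1, b2⟩ := key (hζ.fderiv_apply (unitVec j))
      ((tsupport_fderiv_apply_subset ℝ _).trans hζη) (w := fun n => v i n - u i)
      (fun n => (hv i n).continuous.aestronglyMeasurable.sub (hu.memLp i).1) (hva i)
    refine (tendsto_eLpNorm_add a1 b1 a2 b2).congr fun n => ?_
    congr 1
    ext x
    simp only [hfd, Pi.add_apply, Pi.sub_apply]
    ring
  have hsum := tendsto_finsetSum Finset.univ fun i (_ : i ∈ Finset.univ) =>
    tendsto_finsetSum Finset.univ fun j (_ : j ∈ Finset.univ) => hlim i j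
  refine (integral_sum_sum fun i j => (hA i j).integrable_mul (hH i j)).trans ?_
  refine tendsto_nhds_unique hsum (tendsto_const_nhds.congr fun n => ?_)
  exact (hzero n).symm.trans
    (integral_sum_sum fun i j => (hA i j).integrable_mul (hHn i j n))

/-! ### Real-valued `L²` norms and integrability. -/

/-- The `L²` norm as a real number. -/
noncomputable def normTwo (f : Plane → ℝ) : ℝ := (eLpNorm f 2 volume).toReal

theorem normTwo_nonneg (f : Plane → ℝ) : 0 ≤ normTwo f := ENNReal.toReal_nonneg

theorem integral_sq_eq_normTwo_sq {f : Plane → ℝ} (hf : AEStronglyMeasurable f volume) :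
    ∫ x, f x ^ 2 = normTwo f ^ 2 := by
  rw [normTwo, ← ENNReal.toReal_pow, eLpNorm_two_sq,
    integral_eq_lintegral_of_nonneg_ae (Eventually.of_forall fun x => sq_nonneg _) (hf.pow 2)]
  congr 1
  refine lintegral_congr fun x => ?_
  rw [← ofReal_norm, ← ENNReal.ofReal_pow (norm_nonneg _), Real.norm_eq_abs, sq_abs]

theorem normTwo_le_of_integral_sq_le {f : Plane → ℝ} (hf : AEStronglyMeasurable f volume) {M : ℝ}
    (hM : 0 ≤ M) (h : ∫ x, f x ^ 2 ≤ M ^ 2) : normTwo f ≤ M := by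
  rw [integral_sq_eq_normTwo_sq hf] at h
  exact (sq_le_sq₀ (normTwo_nonneg f) hM).1 h

theorem integral_abs_mul_abs_le {f g : Plane → ℝ} (hf : MemLp f 2 volume) (hg : MemLp g 2 volume) :
    ∫ x, |f x| * |g x| ≤ normTwo f * normTwo g := by
  have h1 := eLpNorm_smul_le_mul_eLpNorm (p := 2) (q := 2) (r := 1) hg.1 hf.1
  have h2 : ∫ x, |f x| * |g x| = (eLpNorm (f • g) 1 volume).toReal := by
    rw [eLpNorm_one_eq_lintegral_enorm, ← integral_norm_eq_lintegral_enorm (hf.1.smul hg.1)]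
    simp
  rw [h2, normTwo, normTwo, ← ENNReal.toReal_mul]
  exact ENNReal.toReal_mono (ENNReal.mul_ne_top hf.2.ne hg.2.ne) h1

theorem integrable_sum_sum {X : Type*} [MeasurableSpace X] {μ : Measure X}
    {f : Fin 2 → Fin 2 → X → ℝ} (hf : ∀ i j, Integrable (f i j) μ) :
    Integrable (fun x => ∑ i, ∑ j, f i j x) μ :=
  integrable_finsetSum _ fun i _ => integrable_finsetSum _ fun j _ => hf i j

theorem integrable_frobSq {G : Plane → Matrix (Fin 2) (Fin 2) ℝ}
    (hG : ∀ i j, MemLp (fun x => G x i j) 2 volume) :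
    Integrable (fun x => frobSq (G x)) volume :=
  integrable_sum_sum fun i j => (hG i j).integrable_sq

theorem IsProfile.integrable_legendre_det {ρ : ℝ → ℝ} {γ s₀ κ : ℝ} (hρ : IsProfile ρ γ s₀ κ)
    {G : Plane → Matrix (Fin 2) (Fin 2) ℝ} (hG : ∀ i j, MemLp (fun x => G x i j) 2 volume) :
    Integrable (fun x => legendre ρ (G x).det) volume := by
  refine Integrable.mono' ((integrable_frobSq hG).const_mul γ) ?_ (Eventually.of_forall fun x => ?_)
  · have hc : Continuous (legendre ρ) :=
      (continuous_id.mul hρ.continuous_deriv).sub hρ.differentiable.continuous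
    exact hc.comp_aestronglyMeasurable (aestronglyMeasurable_det fun i j => (hG i j).1)
  · refine (hρ.abs_legendre_le _).trans (mul_le_mul_of_nonneg_left ?_ hρ.gamma_pos.le)
    have h0 : 0 ≤ frobSq (G x) := by unfold frobSq; positivity
    linarith [abs_det_le_frobSq (G x)]

theorem IsTestFunction.exists_lipschitz {Ω : Set Plane} {η : Plane → ℝ} (hη : IsTestFunction Ω η) :
    ∃ C, 0 ≤ C ∧ ∀ x y, |η x - η y| ≤ C * ‖x - y‖ := by
  obtain ⟨C, hC⟩ := ContDiff.lipschitzWith_of_hasCompactSupport hη.compact hη.smooth (by simp)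
  refine ⟨C, C.2, fun x y => ?_⟩
  simpa [Real.dist_eq, dist_eq_norm] using hC.dist_le_mul x y

theorem norm_smul_unitVec {s : ℝ} (hs : 0 ≤ s) (k : Fin 2) : ‖s • unitVec k‖ = s := by
  simp [norm_smul, abs_of_nonneg hs]

/-- Discrete integration by parts: the translation moves to `z`, whose Lipschitz bound supplies the
factor `‖y‖`. Only integrability of `f` is needed, as is the case for `legendre ρ (det ∇u)`. -/
theorem abs_integral_difference_le {f z : Plane → ℝ} (hf : Integrable f volume) {Ω : Set Plane}
    (hz : IsTestFunction Ω z) {C : ℝ} (hC : ∀ x y, |z x - z y| ≤ C * ‖x - y‖) (y : Plane) :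
    |∫ x, z x * (f (x + y) - f x)| ≤ C * ‖y‖ * ∫ x, |f x| := by
  obtain ⟨B, hB⟩ := hz.exists_abs_le
  have i1 : Integrable (fun x => z x * f x) volume :=
    hf.bdd_mul hz.smooth.continuous.aestronglyMeasurable (Eventually.of_forall hB)
  have i2 : Integrable (fun x => z x * f (x + y)) volume :=
    (hf.comp_add_right y).bdd_mul hz.smooth.continuous.aestronglyMeasurable
      (Eventually.of_forall hB)
  have i3 : Integrable (fun x => z (x - y) * f x) volume := by
    simpa using i2.comp_sub_right y
  have e : ∫ x, z x * f (x + y) = ∫ x, z (x - y) * f x := by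
    simpa using integral_add_right_eq_self (μ := (volume : Measure Plane))
      (fun x => z (x - y) * f x) y
  have e2 : ∫ x, z x * (f (x + y) - f x) = ∫ x, (z (x - y) - z x) * f x := by
    simp only [mul_sub, sub_mul]
    rw [integral_sub i2 i1, e, integral_sub i3 i1]
  rw [e2, ← integral_const_mul]
  refine abs_integral_le_integral_abs.trans (integral_mono ?_ (hf.abs.const_mul _) fun x => ?_)
  · simp only [sub_mul]
    exact (i3.sub i1).abs
  · simp only [abs_mul]
    refine mul_le_mul_of_nonneg_right ?_ (abs_nonneg _)
    simpa using hC (x - y) x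

/-! ### The Caccioppoli-type inequality and its self-improvement. -/

/-- The localized squared `L²` norm of the differences of `G` in the direction `e_k`. -/
noncomputable def localizedDiffSq (η : Plane → ℝ) (G : Plane → Matrix (Fin 2) (Fin 2) ℝ)
    (k : Fin 2) (t : ℝ) : ℝ :=
  ∫ x, η x ^ 2 * frobSq (G (x + t • unitVec k) - G x)

theorem IsTestFunction.integrable_mul {Ω : Set Plane} {η f : Plane → ℝ} (hη : IsTestFunction Ω η)
    (hf : Integrable f volume) : Integrable (fun x => η x * f x) volume := by
  obtain ⟨B, hB⟩ := hη.exists_abs_le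
  exact hf.bdd_mul hη.smooth.continuous.aestronglyMeasurable (Eventually.of_forall hB)

theorem memLp_shift_sub {f : Plane → ℝ} (hf : MemLp f 2 volume) (y : Plane) :
    MemLp (fun x => f (x + y) - f x) 2 volume := (hf.comp_add_right_plane y).sub hf

theorem normTwo_component_le {Ω : Set Plane} {η : Plane → ℝ} (hη : IsTestFunction Ω η)
    {G : Plane → Matrix (Fin 2) (Fin 2) ℝ} (hG : ∀ i j, MemLp (fun x => G x i j) 2 volume)
    {k : Fin 2} {t M : ℝ} (hM : 0 ≤ M) (hQ : localizedDiffSq η G k t ≤ M ^ 2) (i j : Fin 2) :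
    normTwo (fun x => η x * (G (x + t • unitVec k) i j - G x i j)) ≤ M := by
  have hm := fun i j => memLp_shift_sub (hG i j) (t • unitVec k)
  refine normTwo_le_of_integral_sq_le (hη.memLp_mul (hm i j)).1 hM (le_trans ?_ hQ)
  refine integral_mono (hη.memLp_mul (hm i j)).integrable_sq
    (hη.sq.integrable_mul (integrable_frobSq (G := fun x => G (x + t • unitVec k) - G x) hm))
    fun x => ?_
  simp only [mul_pow]
  refine mul_le_mul_of_nonneg_left ?_ (sq_nonneg _)
  have h1 := Finset.single_le_sum (f := fun j => (G (x + t • unitVec k) - G x) i j ^ 2)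
    (fun _ _ => sq_nonneg _) (Finset.mem_univ j)
  have h2 := Finset.single_le_sum (f := fun i => ∑ j, (G (x + t • unitVec k) - G x) i j ^ 2)
    (fun _ _ => Finset.sum_nonneg fun _ _ => sq_nonneg _) (Finset.mem_univ i)
  exact h1.trans h2

/-- Integrate `stress_difference_estimate`: the stress term vanishes by `cutoff_identity`, and all
the others are of order `h²` except the Taylor remainder. That one pairs `|∇u|` in `L²` with a
remainder of norm at most `h M`, hence the term linear in `M`. -/
theorem IsWeakSolution.localizedDiffSq_le {ρ : ℝ → ℝ} {γ s₀ κ : ℝ} (hρ : IsProfile ρ γ s₀ κ)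
    (hγ : γ < 1) {Ω : Set Plane} (hΩ : IsOpen Ω) {u : Fin 2 → Plane → ℝ}
    {G : Plane → Matrix (Fin 2) (Fin 2) ℝ} (hu : IsWeakSolution ρ Ω u G)
    {η : Plane → ℝ} (hη : IsTestFunction Ω η) (hη0 : ∀ x, 0 ≤ η x) (hη1 : ∀ x, η x ≤ 1)
    {δ : ℝ} (hδΩ : Metric.cthickening δ (tsupport η) ⊆ Ω) (k : Fin 2) :
    ∃ C, 0 ≤ C ∧ ∀ h ∈ Ioc 0 δ, ∀ M, 0 ≤ M → (∀ s ∈ Ioc 0 h, localizedDiffSq η G k s ≤ M ^ 2) →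
      localizedDiffSq η G k h ≤ C * h ^ 2 + C * h * M := by
  have hG := hu.memLp_grad
  have hc0 : 0 < (1 - γ) / 2 := by linarith
  set z : Fin 2 → Plane → ℝ := fun j x => fderiv ℝ (fun x => η x ^ 2) x (unitVec j) with hz
  have hzt : ∀ j, IsTestFunction Ω (z j) := fun j => hη.sq.fderiv_apply (unitVec j)
  have hz_eq : ∀ j x, z j x = 2 * η x * fderiv ℝ η x (unitVec j) := fun j x => by
    have hd : HasFDerivAt (fun x => η x ^ 2) _ x :=
      ((hη.smooth.differentiable (by simp)) x).hasFDerivAt.pow 2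
    simp only [hz]
    rw [hd.fderiv]; simp
  -- Cutting off with `η²` rather than `η` makes `∇(η²) = 2 η ∇η` bounded by a multiple of `η`, as
  -- the absorption requires.
  obtain ⟨L, hL0, hL⟩ : ∃ L, 0 ≤ L ∧ ∀ j x, |z j x| ≤ L * η x := by
    choose B hB using fun j => (hη.fderiv_apply (unitVec j)).exists_abs_le
    have hB0 : ∀ j, 0 ≤ B j := fun j => (abs_nonneg _).trans (hB j 0)
    refine ⟨2 * (B 0 + B 1), by linarith [hB0 0, hB0 1], fun j x => ?_⟩
    have : |fderiv ℝ η x (unitVec j)| ≤ B 0 + B 1 := by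
      refine (hB j x).trans ?_
      have h0 := hB0 0
      have h1 := hB0 1
      fin_cases j <;> simp <;> linarith
    rw [hz_eq, abs_mul, abs_mul, abs_two, abs_of_nonneg (hη0 x)]
    nlinarith [mul_le_mul_of_nonneg_left this (hη0 x)]
  obtain ⟨L₂, hL₂0, hL₂⟩ := (hzt k).exists_lipschitz
  set Γ : Plane → ℝ := fun x => legendre ρ (G x).det with hΓ
  have hΓi : Integrable Γ volume := hρ.integrable_legendre_det hG
  have hF := integrable_frobSq hG
  -- `B` gathers the contributions of order `h²`; `D` is the coefficient of `h M` from the Taylor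
  -- remainder.
  set B : ℝ := L₂ * (∫ x, |Γ x|) + 4 * L ^ 2 / (1 - γ) * (∑ i, normTwo (fun x => G x i k) ^ 2)
    + L ^ 2 * (2 * ∫ x, frobSq (G x)) with hBdef
  set D : ℝ := L * ((∑ i, ∑ j, normTwo (fun x => G x i j)) * 2) with hDdef
  have hB0 : 0 ≤ B := by
    have h1 : 0 ≤ ∫ x, |Γ x| := integral_nonneg fun x => abs_nonneg _
    have h2 : 0 ≤ ∫ x, frobSq (G x) := integral_nonneg fun x => by
      simp only [frobSq, Pi.zero_apply]; positivity
    have h3 : 0 ≤ ∑ i, normTwo (fun x => G x i k) ^ 2 := Finset.sum_nonneg fun _ _ => sq_nonneg _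
    have h4 : 0 ≤ 4 * L ^ 2 / (1 - γ) := div_nonneg (by positivity) (by linarith)
    positivity
  have hD0 : 0 ≤ D := by
    have : 0 ≤ ∑ i, ∑ j, normTwo (fun x => G x i j) :=
      Finset.sum_nonneg fun _ _ => Finset.sum_nonneg fun _ _ => normTwo_nonneg _
    positivity
  refine ⟨(B + D) / ((1 - γ) / 2), by positivity, fun h hh M hM hQ => ?_⟩
  set y : Plane := h • unitVec k with hy
  have hh0 : 0 < h := hh.1
  have hδ0 : 0 ≤ δ := hh0.le.trans hh.2
  set K := tsupport η with hK
  have hKc : IsCompact K := hη.compact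
  set K' := Metric.cthickening δ K with hK'
  have hK'c : IsCompact K' := hKc.cthickening
  have hKs : ∀ x ∈ K, ∀ s ∈ Icc 0 h, x + s • unitVec k ∈ K' := fun x hx s hs => by
    refine Metric.mem_cthickening_of_dist_le _ x δ K hx ?_
    rw [dist_eq_norm, add_sub_cancel_left, norm_smul_unitVec hs.1]
    exact hs.2.trans hh.2
  have hKK' : K ⊆ K' := Metric.self_subset_cthickening K
  have hηne : ∀ x, η x ≠ 0 → x ∈ K := fun x hx => subset_tsupport _ hx
  -- the Taylor remainder and the first difference of `u`
  set χ : Plane → ℝ := K.indicator fun _ => 1 with hχ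
  have hχm : Measurable χ := measurable_const.indicator hKc.measurableSet
  have hχ1 : ∀ x, |χ x| ≤ 1 := fun x => by
    by_cases hx : x ∈ K <;> simp [hχ, hx]
  have hηχ : ∀ x, η x * χ x = η x := fun x => by
    by_cases hx : x ∈ K
    · simp [hχ, hx]
    · simp [hχ, hx, image_eq_zero_of_notMem_tsupport hx]
  -- Replacing the increment of `u` by `χ` times it changes no term weighted by `η` or `z`, but
  -- localizes the unweighted sum of squares, so that the increment bound inside `Ω` applies.
  have hzχ : ∀ j x, z j x * χ x = z j x := fun j x => by
    rw [hz_eq]; linear_combination (2 * fderiv ℝ η x (unitVec j)) * hηχ x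
  have hdiff : ∀ i, normTwo (fun x => χ x * (u i (x + y) - u i x))
      ≤ h * normTwo (fun x => G x i k) := fun i => by
    have h1 := (sobolev_difference_estimates (hu.memLp i) (hG i) hΩ hK'c hδΩ (hu.weak i) hχm hχ1
      (k := k) hh0 fun x hx s hs => hKs x (by_contra fun hx' => hx (by simp [hχ, hx'])) s hs).1
    have h2 := ENNReal.toReal_mono (ENNReal.mul_ne_top ENNReal.ofReal_ne_top (hG i k).2.ne) h1
    rwa [ENNReal.toReal_mul, ENNReal.toReal_ofReal hh0.le] at h2
  have htay : ∀ i, normTwo (fun x => η x * (u i (x + y) - u i x - h * G x i k)) ≤ h * M :=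
    fun i => by
    have h1 := (sobolev_difference_estimates (hu.memLp i) (hG i) hΩ hK'c hδΩ (hu.weak i)
      hη.smooth.continuous.measurable
      (fun x => by rw [abs_of_nonneg (hη0 x)]; exact hη1 x)
      (k := k) hh0 fun x hx s hs => hKs x (hηne x hx) s hs).2 (ENNReal.ofReal M) fun s hs => by
        have h3 := normTwo_component_le hη hG hM (hQ s hs) i k
        exact (ENNReal.le_ofReal_iff_toReal_le
          (hη.memLp_mul (memLp_shift_sub (hG i k) (s • unitVec k))).2.ne hM).2 h3
    have h2 := ENNReal.toReal_mono
      (ENNReal.mul_ne_top ENNReal.ofReal_ne_top ENNReal.ofReal_ne_top) h1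
    rwa [ENNReal.toReal_mul, ENNReal.toReal_ofReal hh0.le, ENNReal.toReal_ofReal hM] at h2
  -- integrability
  have hA : ∀ i j, MemLp (fun x => stress ρ (G (x + y)) i j - stress ρ (G x) i j) 2 volume :=
    fun i j => memLp_shift_sub (hρ.memLp_stress hγ hG i j) y
  have hH : ∀ i j, MemLp (fun x => η x ^ 2 * (G (x + y) i j - G x i j)
        + z j x * (u i (x + y) - u i x)) 2 volume := fun i j =>
    (hη.sq.memLp_mul (memLp_shift_sub (hG i j) y)).add
      ((hzt j).memLp_mul (memLp_shift_sub (hu.memLp i) y))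
  have hχL : ∀ i, MemLp (fun x => χ x * (u i (x + y) - u i x)) 2 volume := fun i =>
    (memLp_shift_sub (hu.memLp i) y).mono (hχm.aestronglyMeasurable.mul
      (memLp_shift_sub (hu.memLp i) y).1) (Eventually.of_forall fun x => by
        rw [norm_mul]; exact mul_le_of_le_one_left (norm_nonneg _) (hχ1 x))
  have hRL : ∀ i, MemLp (fun x => η x * (u i (x + y) - u i x - h * G x i k)) 2 volume := fun i =>
    hη.memLp_mul ((memLp_shift_sub (hu.memLp i) y).sub ((hG i k).const_mul h))
  have iQ : Integrable (fun x => η x ^ 2 * frobSq (G (x + y) - G x)) volume :=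
    hη.sq.integrable_mul (integrable_frobSq (G := fun x => G (x + y) - G x)
      fun i j => memLp_shift_sub (hG i j) y)
  have iP : Integrable (fun x => ∑ i, ∑ j, (stress ρ (G (x + y)) i j - stress ρ (G x) i j)
      * (η x ^ 2 * (G (x + y) i j - G x i j) + z j x * (u i (x + y) - u i x))) volume :=
    integrable_sum_sum fun i j => (hA i j).integrable_mul (hH i j)
  have iΓ : Integrable (fun x => z k x * (Γ (x + y) - Γ x)) volume :=
    (hzt k).integrable_mul ((hΓi.comp_add_right y).sub hΓi)
  have iχ : Integrable (fun x => ∑ i, (χ x * (u i (x + y) - u i x)) ^ 2) volume :=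
    integrable_finsetSum _ fun i _ => (hχL i).integrable_sq
  have iR1 : ∀ i j l, Integrable
      (fun x => |G x i j| * |η x * (u l (x + y) - u l x - h * G x l k)|) volume := fun i j l =>
    (hG i j).abs.integrable_mul (hRL l).abs
  have iR : Integrable (fun x => ∑ i, ∑ j, ∑ l,
      |G x i j| * |η x * (u l (x + y) - u l x - h * G x l k)|) volume :=
    integrable_sum_sum fun i j => integrable_finsetSum _ fun l _ => iR1 i j l
  have iF : Integrable (fun x => frobSq (G x) + frobSq (G (x + y))) volume :=
    hF.add (hF.comp_add_right y)
  -- the pointwise inequality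
  have hpt : ∀ x, (1 - γ) / 2 * (η x ^ 2 * frobSq (G (x + y) - G x)) ≤
      (∑ i, ∑ j, (stress ρ (G (x + y)) i j - stress ρ (G x) i j)
        * (η x ^ 2 * (G (x + y) i j - G x i j) + z j x * (u i (x + y) - u i x)))
      - h * (z k x * (Γ (x + y) - Γ x))
      + 4 * L ^ 2 / (1 - γ) * (∑ i, (χ x * (u i (x + y) - u i x)) ^ 2)
      + L * (∑ i, ∑ j, ∑ l, |G x i j| * |η x * (u l (x + y) - u l x - h * G x l k)|)
      + h ^ 2 * L ^ 2 * (frobSq (G x) + frobSq (G (x + y))) := by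
    intro x
    have h1 := stress_difference_estimate hρ hγ (G x) (G (x + y)) (fun j => z j x)
      (fun i => χ x * (u i (x + y) - u i x)) (hη0 x) (fun j => hL j x) hh0.le k
    have e1 : ∀ i j, z j x * (χ x * (u i (x + y) - u i x)) = z j x * (u i (x + y) - u i x) :=
      fun i j => by rw [← mul_assoc, hzχ]
    have e2 : ∀ l, η x * (χ x * (u l (x + y) - u l x) - h * G x l k)
        = η x * (u l (x + y) - u l x - h * G x l k) := fun l => by
      linear_combination (u l (x + y) - u l x) * hηχ x
    simp only [e1, e2] at h1
    refine h1.trans (le_of_eq ?_)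
    simp only [hΓ, Fin.sum_univ_two]
    ring
  have hint := integral_mono (iQ.const_mul _) (((((iP.sub (iΓ.const_mul h)).add
    (iχ.const_mul _)).add (iR.const_mul _)).add (iF.const_mul _))) hpt
  have hPzero := hu.cutoff_identity hρ hγ hΩ hη hK'c hδΩ (y := y) hKK' fun x hx =>
    hKs x hx h ⟨hh0.le, le_rfl⟩
  have e1 : ∫ x, ((((((∑ i, ∑ j, (stress ρ (G (x + y)) i j - stress ρ (G x) i j)
        * (η x ^ 2 * (G (x + y) i j - G x i j) + z j x * (u i (x + y) - u i x)))
      - h * (z k x * (Γ (x + y) - Γ x)))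
      + 4 * L ^ 2 / (1 - γ) * (∑ i, (χ x * (u i (x + y) - u i x)) ^ 2))
      + L * (∑ i, ∑ j, ∑ l, |G x i j| * |η x * (u l (x + y) - u l x - h * G x l k)|)))
      + h ^ 2 * L ^ 2 * (frobSq (G x) + frobSq (G (x + y))))
      = 0 - h * (∫ x, z k x * (Γ (x + y) - Γ x))
        + 4 * L ^ 2 / (1 - γ) * (∫ x, ∑ i, (χ x * (u i (x + y) - u i x)) ^ 2)
        + L * (∫ x, ∑ i, ∑ j, ∑ l, |G x i j| * |η x * (u l (x + y) - u l x - h * G x l k)|)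
        + h ^ 2 * L ^ 2 * (∫ x, (frobSq (G x) + frobSq (G (x + y)))) := by
    refine (integral_add (((iP.sub (iΓ.const_mul h)).add
      (iχ.const_mul _)).add (iR.const_mul _)) (iF.const_mul _)).trans ?_
    refine congrArg₂ _ ?_ (integral_const_mul _ _)
    refine (integral_add ((iP.sub (iΓ.const_mul h)).add
      (iχ.const_mul _)) (iR.const_mul _)).trans ?_
    refine congrArg₂ _ ?_ (integral_const_mul _ _)
    refine (integral_add (iP.sub (iΓ.const_mul h)) (iχ.const_mul _)).trans ?_
    refine congrArg₂ _ ?_ (integral_const_mul _ _)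
    refine (integral_sub iP (iΓ.const_mul h)).trans ?_
    exact congrArg₂ _ hPzero (integral_const_mul _ _)
  have hint2 := hint.trans (le_of_eq e1)
  rw [integral_const_mul] at hint2
  have t1 : |∫ x, z k x * (Γ (x + y) - Γ x)| ≤ L₂ * h * ∫ x, |Γ x| := by
    have := abs_integral_difference_le hΓi (hzt k) hL₂ y
    rwa [hy, norm_smul_unitVec hh0.le] at this
  have t2 : ∫ x, ∑ i, (χ x * (u i (x + y) - u i x)) ^ 2
      ≤ h ^ 2 * ∑ i, normTwo (fun x => G x i k) ^ 2 := by
    rw [integral_finsetSum _ fun i _ => (hχL i).integrable_sq, Finset.mul_sum]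
    refine Finset.sum_le_sum fun i _ => ?_
    rw [integral_sq_eq_normTwo_sq (hχL i).1, ← mul_pow]
    exact pow_le_pow_left₀ (normTwo_nonneg _) (hdiff i) 2
  have t3 : ∫ x, ∑ i, ∑ j, ∑ l, |G x i j| * |η x * (u l (x + y) - u l x - h * G x l k)|
      ≤ (∑ i, ∑ j, normTwo (fun x => G x i j)) * 2 * (h * M) := by
    rw [integral_sum_sum fun i j => integrable_finsetSum _ fun l _ => iR1 i j l, mul_assoc,
      Finset.sum_mul]
    refine Finset.sum_le_sum fun i _ => ?_
    rw [Finset.sum_mul]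
    refine Finset.sum_le_sum fun j _ => ?_
    rw [integral_finsetSum _ fun l _ => iR1 i j l]
    refine (Finset.sum_le_sum fun l _ => (integral_abs_mul_abs_le (hG i j) (hRL l)).trans
      (mul_le_mul_of_nonneg_left (htay l) (normTwo_nonneg _))).trans (le_of_eq ?_)
    simp only [Fin.sum_univ_two]; ring
  have t4 : ∫ x, (frobSq (G x) + frobSq (G (x + y))) = 2 * ∫ x, frobSq (G x) := by
    rw [integral_add hF (hF.comp_add_right y),
      integral_add_right_eq_self (fun x => frobSq (G x)) y]
    ring
  have hγ' : 0 ≤ 4 * L ^ 2 / (1 - γ) := div_nonneg (by positivity) (by linarith)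
  have hfin : (1 - γ) / 2 * localizedDiffSq η G k h ≤ B * h ^ 2 + D * (h * M) := by
    have s1 := mul_le_mul_of_nonneg_left (abs_le.1 t1).1 hh0.le
    have s2 := mul_le_mul_of_nonneg_left t2 hγ'
    have s3 := mul_le_mul_of_nonneg_left t3 hL0
    rw [t4] at hint2
    refine hint2.trans ?_
    rw [hBdef, hDdef]
    linarith
  have e3 : (B + D) / ((1 - γ) / 2) * h ^ 2 + (B + D) / ((1 - γ) / 2) * h * M
      = ((B + D) * h ^ 2 + (B + D) * (h * M)) / ((1 - γ) / 2) := by ring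
  rw [e3, le_div_iff₀ hc0]
  have p1 : 0 ≤ D * h ^ 2 := by positivity
  have p2 : 0 ≤ B * (h * M) := by positivity
  linarith

/-- The supremum `S` of `√Q` on `(0, h]` is finite by the a priori bound, and the hypothesis at
every `s ≤ h` gives `S² ≤ C h² + C h S`. This fails if `S > (C + 1) h`. -/
theorem le_sq_of_self_improving {Q : ℝ → ℝ} {δ B C : ℝ}
    (hQB : ∀ t, Q t ≤ B) (hC : 0 ≤ C)
    (hQ : ∀ h ∈ Ioc 0 δ, ∀ M, 0 ≤ M → (∀ s ∈ Ioc 0 h, Q s ≤ M ^ 2) → Q h ≤ C * h ^ 2 + C * h * M)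
    {h : ℝ} (hh : h ∈ Ioc 0 δ) : Q h ≤ ((C + 1) * h) ^ 2 := by
  set S := sSup ((fun s => √(Q s)) '' Ioc 0 h) with hS
  have hbdd : BddAbove ((fun s => √(Q s)) '' Ioc 0 h) :=
    ⟨√B, by rintro _ ⟨s, -, rfl⟩; exact Real.sqrt_le_sqrt (hQB s)⟩
  have hle : ∀ s ∈ Ioc 0 h, √(Q s) ≤ S := fun s hs => le_csSup hbdd ⟨s, hs, rfl⟩
  have hmem : h ∈ Ioc 0 h := ⟨hh.1, le_rfl⟩
  have hS0 : 0 ≤ S := (Real.sqrt_nonneg _).trans (hle h hmem)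
  have hQS : ∀ s ∈ Ioc 0 h, Q s ≤ S ^ 2 := fun s hs => (Real.sqrt_le_left hS0).1 (hle s hs)
  have h1 : ∀ s ∈ Ioc 0 h, Q s ≤ C * h ^ 2 + C * h * S := fun s hs => by
    refine (hQ s ⟨hs.1, hs.2.trans hh.2⟩ S hS0 fun r hr => hQS r ⟨hr.1, hr.2.trans hs.2⟩).trans ?_
    have hs0 := hs.1.le
    have := hs.2
    gcongr
  have h2 : S ≤ √(C * h ^ 2 + C * h * S) :=
    csSup_le ⟨_, h, hmem, rfl⟩ (by rintro _ ⟨s, hs, rfl⟩; exact Real.sqrt_le_sqrt (h1 s hs))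
  have hh0 := hh.1
  have h3 : S ^ 2 ≤ C * h ^ 2 + C * h * S := (Real.le_sqrt hS0 (by positivity)).1 h2
  have h4 : S ≤ (C + 1) * h := by
    by_contra! hlt
    nlinarith [mul_nonneg hC hS0, mul_pos hh0 hh0, mul_nonneg hC hh0.le]
  exact (hQS h hmem).trans (pow_le_pow_left₀ hS0 h4 2)

/-- Difference quotients of the gradient of a weak solution are locally bounded in `L²`. -/
theorem IsWeakSolution.exists_normTwo_diff_le {ρ : ℝ → ℝ} {γ s₀ κ : ℝ} (hρ : IsProfile ρ γ s₀ κ)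
    (hγ : γ < 1) {Ω : Set Plane} (hΩ : IsOpen Ω) {u : Fin 2 → Plane → ℝ}
    {G : Plane → Matrix (Fin 2) (Fin 2) ℝ} (hu : IsWeakSolution ρ Ω u G)
    {η : Plane → ℝ} (hη : IsTestFunction Ω η) (hη0 : ∀ x, 0 ≤ η x) (hη1 : ∀ x, η x ≤ 1)
    (k : Fin 2) :
    ∃ δ > 0, ∃ C, 0 ≤ C ∧ ∀ h ∈ Ioc 0 δ, ∀ i j,
      normTwo (fun x => η x * (G (x + h • unitVec k) i j - G x i j)) ≤ C * h := by
  obtain ⟨δ, hδ, hδΩ⟩ := hη.compact.isCompact.exists_cthickening_subset_open hΩ hη.support_subset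
  obtain ⟨C, hC, hQ⟩ := hu.localizedDiffSq_le hρ hγ hΩ hη hη0 hη1 hδΩ k
  have hfr : ∀ ξ : Matrix (Fin 2) (Fin 2) ℝ, 0 ≤ frobSq ξ := fun ξ => by
    unfold frobSq; positivity
  have hF := integrable_frobSq hu.memLp_grad
  -- A crude bound, uniform in the increment; its only purpose is to make the supremum in
  -- `le_sq_of_self_improving` finite.
  have hB : ∀ t, localizedDiffSq η G k t ≤ 4 * ∫ x, frobSq (G x) := fun t => by
    set y := t • unitVec k
    have hle : ∀ x, η x ^ 2 * frobSq (G (x + y) - G x)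
        ≤ 2 * frobSq (G (x + y)) + 2 * frobSq (G x) := fun x => by
      refine (mul_le_of_le_one_left (hfr _) (pow_le_one₀ (hη0 x) (hη1 x))).trans ?_
      simp only [frobSq, Fin.sum_univ_two, Matrix.sub_apply]
      nlinarith [sq_nonneg (G (x + y) 0 0 + G x 0 0), sq_nonneg (G (x + y) 0 1 + G x 0 1),
        sq_nonneg (G (x + y) 1 0 + G x 1 0), sq_nonneg (G (x + y) 1 1 + G x 1 1)]
    have h1 := integral_mono (hη.sq.integrable_mul (integrable_frobSq
      (G := fun x => G (x + y) - G x) fun i j => memLp_shift_sub (hu.memLp_grad i j) y))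
      (((hF.comp_add_right y).const_mul 2).add (hF.const_mul 2)) hle
    refine h1.trans (le_of_eq ?_)
    refine (integral_add ((hF.comp_add_right y).const_mul 2) (hF.const_mul 2)).trans ?_
    rw [integral_const_mul, integral_const_mul,
      integral_add_right_eq_self (fun x => frobSq (G x)) y]
    ring
  refine ⟨δ, hδ, C + 1, by linarith, fun h hh i j => ?_⟩
  refine normTwo_component_le hη hu.memLp_grad (by have := hh.1; positivity) ?_ i j
  exact le_sq_of_self_improving hB hC hQ hh

/-! ### From difference quotients to weak derivatives. -/

/-- The bound forces `L` to vanish on the kernel of `ι`, so `L` descends to a bounded functional on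
the range. The range need not be closed; Hahn–Banach extends the functional to `H`, where Riesz
represents it. -/
theorem exists_inner_eq_of_bound {T H : Type*} [AddCommGroup T] [Module ℝ T]
    [NormedAddCommGroup H] [InnerProductSpace ℝ H] [CompleteSpace H] (ι : T →ₗ[ℝ] H)
    (L : T →ₗ[ℝ] ℝ) {C : ℝ} (hL : ∀ t, |L t| ≤ C * ‖ι t‖) : ∃ g : H, ∀ t, L t = inner ℝ g (ι t) := by
  have hker : LinearMap.ker ι ≤ LinearMap.ker L := fun t ht => by
    have h1 := hL t
    rw [LinearMap.mem_ker.1 ht, norm_zero, mul_zero] at h1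
    exact abs_nonpos_iff.1 h1
  let L' : LinearMap.range ι →ₗ[ℝ] ℝ :=
    ((LinearMap.ker ι).liftQ L hker).comp ι.quotKerEquivRange.symm.toLinearMap
  have hL' : ∀ t, L' ⟨ι t, t, rfl⟩ = L t := fun t => by
    have : ι.quotKerEquivRange.symm ⟨ι t, t, rfl⟩ = (LinearMap.ker ι).mkQ t := by
      rw [LinearEquiv.symm_apply_eq]
      ext
      simp
    simp [L', this]
  let L'' : StrongDual ℝ (LinearMap.range ι) := L'.mkContinuous C (by
    rintro ⟨_, t, rfl⟩
    rw [hL']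
    exact hL t)
  obtain ⟨g, hg, -⟩ := exists_extension_norm_eq _ L''
  refine ⟨(InnerProductSpace.toDual ℝ H).symm g, fun t => ?_⟩
  rw [InnerProductSpace.toDual_symm_apply, ← hL' t]
  exact (hg ⟨ι t, t, rfl⟩).symm

theorem IsTestFunction.zero (V : Set Plane) : IsTestFunction V (0 : Plane → ℝ) where
  smooth := contDiff_const
  compact := HasCompactSupport.zero
  support_subset := by simp [tsupport]

theorem IsTestFunction.add {V : Set Plane} {φ ψ : Plane → ℝ} (hφ : IsTestFunction V φ)
    (hψ : IsTestFunction V ψ) : IsTestFunction V (φ + ψ) where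
  smooth := hφ.smooth.add hψ.smooth
  compact := hφ.compact.add hψ.compact
  support_subset := (tsupport_add φ ψ).trans (union_subset hφ.support_subset hψ.support_subset)

theorem IsTestFunction.const_smul {V : Set Plane} {φ : Plane → ℝ} (c : ℝ)
    (hφ : IsTestFunction V φ) : IsTestFunction V (c • φ) where
  smooth := contDiff_const.smul hφ.smooth
  compact := hφ.compact.smul_left (f := fun _ => c)
  support_subset := (closure_mono (Function.support_const_smul_subset c φ)).trans hφ.support_subset

/-- The space of real-valued test functions on `V`. -/
def testSpace (V : Set Plane) : Submodule ℝ (Plane → ℝ) where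
  carrier := {φ | IsTestFunction V φ}
  add_mem' := fun ha hb => ha.add hb
  zero_mem' := IsTestFunction.zero V
  smul_mem' := fun c _ h => h.const_smul c

theorem abs_integral_mul_le {f g : Plane → ℝ} (hf : MemLp f 2 volume) (hg : MemLp g 2 volume) :
    |∫ x, f x * g x| ≤ normTwo f * normTwo g := by
  refine abs_integral_le_integral_abs.trans (le_trans (le_of_eq ?_) (integral_abs_mul_abs_le hf hg))
  simp [abs_mul]

/-- Integration by parts for difference quotients, in the limit of small increments. -/
theorem abs_integral_fderiv_mul_le {f : Plane → ℝ} (hf : MemLp f 2 volume) {V Ω : Set Plane}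
    {η : Plane → ℝ} (hη : IsTestFunction Ω η) (hη1 : ∀ x ∈ V, η x = 1) {k : Fin 2} {δ C : ℝ}
    (hδ : 0 < δ)
    (hC : ∀ h ∈ Ioc 0 δ, normTwo (fun x => η x * (f (x + h • unitVec k) - f x)) ≤ C * h)
    {φ : Plane → ℝ} (hφ : IsTestFunction V φ) :
    |∫ x, fderiv ℝ φ x (unitVec k) * f x| ≤ C * normTwo φ := by
  have hη_eq : ∀ x, φ x * η x = φ x := fun x => by
    by_cases hx : x ∈ V
    · rw [hη1 x hx, mul_one]
    · rw [image_eq_zero_of_notMem_tsupport fun h => hx (hφ.support_subset h), zero_mul]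
  have hφ2 := hφ.memLp 2 volume
  -- Translating `φ` backwards corresponds, under the integral, to translating `f` forwards.
  set y : Plane := -unitVec k with hy
  have hDy := hφ.memLp_fderiv_apply y 2 volume
  refine le_of_forall_pos_le_add fun ε hε => ?_
  -- Chosen so that `ε' * normTwo f ≤ ε`; the added `1` covers `normTwo f = 0`.
  set ε' : ℝ := ε / (normTwo f + 1) with hε'
  have hf0 := normTwo_nonneg f
  have hε'0 : 0 < ε' := by positivity
  -- a small increment for which the translates of the derivative are close
  have hcont := ENNReal.tendsto_nhds_zero.1 (tendsto_eLpNorm_translate_sub hDy)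
    (ENNReal.ofReal ε') (by simpa using hε'0)
  obtain ⟨r, hr, hr'⟩ := Metric.eventually_nhds_iff.1 hcont
  set h : ℝ := min δ (r / 2) with hh
  have hh0 : 0 < h := lt_min hδ (by positivity)
  have htay : normTwo (fun x => φ (x + h • y) - φ x - h * fderiv ℝ φ x y) ≤ h * ε' := by
    have h1 := eLpNorm_two_smooth_taylor_le hφ.smooth (ψ := fun _ => 1) measurable_const (y := y)
      hh0 (M := ENNReal.ofReal ε') fun s hs => by
        simp only [one_mul]
        refine hr' ?_
        rw [dist_zero_right, hy, smul_neg, norm_neg, norm_smul_unitVec hs.1.le]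
        exact hs.2.trans_lt ((min_le_right _ _).trans_lt (by linarith))
    simp only [one_mul] at h1
    have h2 := ENNReal.toReal_mono
      (ENNReal.mul_ne_top ENNReal.ofReal_ne_top ENNReal.ofReal_ne_top) h1
    rwa [ENNReal.toReal_mul, ENNReal.toReal_ofReal hh0.le, ENNReal.toReal_ofReal hε'0.le] at h2
  have hR : MemLp (fun x => φ (x + h • y) - φ x - h * fderiv ℝ φ x y) 2 volume :=
    (memLp_shift_sub hφ2 _).sub (hDy.const_mul h)
  have hE : MemLp (fun x => η x * (f (x + h • unitVec k) - f x)) 2 volume :=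
    hη.memLp_mul (memLp_shift_sub hf _)
  have b1 := (abs_integral_mul_le hR hf).trans (mul_le_mul_of_nonneg_right htay hf0)
  have b2 := (abs_integral_mul_le hφ2 hE).trans
    (mul_le_mul_of_nonneg_left (hC h ⟨hh0, min_le_left _ _⟩) (normTwo_nonneg φ))
  have i1 : Integrable (fun x => φ (x + h • y) * f x) volume :=
    (hφ2.comp_add_right_plane _).integrable_mul hf
  have i2 : Integrable (fun x => φ x * f x) volume := hφ2.integrable_mul hf
  have i3 : Integrable (fun x => φ x * f (x + h • unitVec k)) volume :=
    hφ2.integrable_mul (hf.comp_add_right_plane _)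
  have i4 : Integrable (fun x => fderiv ℝ φ x (unitVec k) * f x) volume :=
    (hφ.memLp_fderiv_apply _ 2 volume).integrable_mul hf
  have es : ∫ x, φ (x + h • y) * f x = ∫ x, φ x * f (x + h • unitVec k) := by
    rw [← integral_add_right_eq_self (fun x => φ (x + h • y) * f x) (h • unitVec k)]
    simp [hy]
  have e1 : ∫ x, (φ (x + h • y) - φ x - h * fderiv ℝ φ x y) * f x
      = (∫ x, φ x * f (x + h • unitVec k)) - (∫ x, φ x * f x)
        + h * ∫ x, fderiv ℝ φ x (unitVec k) * f x := by
    rw [← es, ← integral_const_mul, ← integral_sub i1 i2]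
    refine Eq.trans ?_ (integral_add (i1.sub i2) (i4.const_mul h))
    refine integral_congr_ae (Eventually.of_forall fun x => ?_)
    simp [hy]; ring
  have e2 : ∫ x, φ x * (η x * (f (x + h • unitVec k) - f x))
      = (∫ x, φ x * f (x + h • unitVec k)) - ∫ x, φ x * f x := by
    rw [← integral_sub i3 i2]
    refine integral_congr_ae (Eventually.of_forall fun x => ?_)
    simp only
    linear_combination (f (x + h • unitVec k) - f x) * hη_eq x
  rw [e1] at b1
  rw [e2] at b2
  set I := ∫ x, fderiv ℝ φ x (unitVec k) * f x
  have b3 : h * |I| ≤ h * (C * normTwo φ + ε' * normTwo f) := by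
    rw [← abs_of_pos hh0, ← abs_mul, abs_of_pos hh0]
    rw [abs_le] at b1 b2 ⊢
    constructor <;> linarith [b1.1, b1.2, b2.1, b2.2]
  have b4 := le_of_mul_le_mul_left b3 hh0
  have b5 : ε' * normTwo f ≤ ε := by
    rw [hε', div_mul_eq_mul_div, div_le_iff₀ (by positivity)]
    nlinarith
  linarith

/-- A function whose difference quotients are bounded in `L²` has a weak derivative in `L²`. -/
theorem exists_weakDeriv_of_diff_bound {f : Plane → ℝ} (hf : MemLp f 2 volume) {V Ω : Set Plane}
    {η : Plane → ℝ} (hη : IsTestFunction Ω η) (hη1 : ∀ x ∈ V, η x = 1) {k : Fin 2} {δ C : ℝ}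
    (hδ : 0 < δ)
    (hC : ∀ h ∈ Ioc 0 δ, normTwo (fun x => η x * (f (x + h • unitVec k) - f x)) ≤ C * h) :
    ∃ g : Plane → ℝ, MemLp g 2 volume ∧ ∀ φ : Plane → ℝ, IsTestFunction V φ →
      ∫ x, fderiv ℝ φ x (unitVec k) * f x = -∫ x, φ x * g x := by
  have hint : ∀ φ : testSpace V, Integrable (fun x => fderiv ℝ φ.1 x (unitVec k) * f x) volume :=
    fun φ => (φ.2.memLp_fderiv_apply _ 2 volume).integrable_mul hf
  have hd : ∀ φ : testSpace V, Differentiable ℝ φ.1 := fun φ =>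
    φ.2.smooth.differentiable (by simp)
  let ι : testSpace V →ₗ[ℝ] Lp ℝ 2 (volume : Measure Plane) :=
    { toFun := fun φ => (φ.2.memLp 2 volume).toLp φ.1
      map_add' := fun φ ψ => rfl
      map_smul' := fun c φ => rfl }
  let L : testSpace V →ₗ[ℝ] ℝ :=
    { toFun := fun φ => ∫ x, fderiv ℝ φ.1 x (unitVec k) * f x
      map_add' := fun φ ψ => by
        rw [← integral_add (hint φ) (hint ψ)]
        refine integral_congr_ae (Eventually.of_forall fun x => ?_)
        simp [fderiv_add (hd φ x) (hd ψ x), add_mul]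
      map_smul' := fun c φ => by
        rw [RingHom.id_apply, smul_eq_mul, ← integral_const_mul]
        refine integral_congr_ae (Eventually.of_forall fun x => ?_)
        simp [fderiv_const_smul (hd φ x), mul_assoc] }
  -- The functional `φ ↦ ∫ (∂_k φ) f` is bounded in the `L²` norm of `φ`; its Riesz representative
  -- is minus the weak derivative.
  have hbound : ∀ φ, |L φ| ≤ C * ‖ι φ‖ := fun φ => by
    have h1 := abs_integral_fderiv_mul_le hf hη hη1 hδ hC φ.2
    have h2 : ‖ι φ‖ = normTwo φ.1 := Lp.norm_toLp _ (φ.2.memLp 2 volume)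
    rw [h2]
    exact h1
  obtain ⟨g, hg⟩ := exists_inner_eq_of_bound ι L hbound
  refine ⟨fun x => -g x, (Lp.memLp g).neg, fun φ hφ => ?_⟩
  have h1 : ∫ x, fderiv ℝ φ x (unitVec k) * f x = inner ℝ g (ι ⟨φ, hφ⟩) := hg ⟨φ, hφ⟩
  rw [h1, L2.inner_def, ← integral_neg]
  refine integral_congr_ae ?_
  filter_upwards [(hφ.memLp 2 volume).coeFn_toLp] with x hx
  have hx' : (ι ⟨φ, hφ⟩ : Plane → ℝ) x = φ x := hx
  rw [hx']
  simp

/-! ### Calculus of weak partial derivatives. -/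

theorem IsTestFunction.mono {F : Type*} [NormedAddCommGroup F] [NormedSpace ℝ F] {V Ω : Set Plane}
    {φ : Plane → F} (hφ : IsTestFunction V φ) (h : V ⊆ Ω) : IsTestFunction Ω φ :=
  ⟨hφ.smooth, hφ.compact, hφ.support_subset.trans h⟩

theorem IsTestFunction.eq_zero {F : Type*} [NormedAddCommGroup F] [NormedSpace ℝ F] {V : Set Plane}
    {φ : Plane → F} (hφ : IsTestFunction V φ) {x : Plane} (hx : x ∉ V) : φ x = 0 :=
  image_eq_zero_of_notMem_tsupport fun h => hx (hφ.support_subset h)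

theorem IsTestFunction.integrable_smul {F : Type*} [NormedAddCommGroup F] [NormedSpace ℝ F]
    {V : Set Plane} {φ : Plane → ℝ} (hφ : IsTestFunction V φ) {f : Plane → F} {μ : Measure Plane}
    [IsFiniteMeasureOnCompacts μ] (hf : MemLp f 2 μ) : Integrable (fun x => φ x • f x) μ :=
  memLp_one_iff_integrable.1 (hf.smul (r := 1) (hφ.memLp 2 μ))

theorem MeasureTheory.MemLp.locallyIntegrableOn_plane {F : Type*} [NormedAddCommGroup F]
    {V : Set Plane} {f : Plane → F} (hf : MemLp f 2 (volume.restrict V)) : LocallyIntegrableOn f V :=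
  locallyIntegrableOn_of_locallyIntegrable_restrict (hf.locallyIntegrable (by norm_num))

/-- The fundamental lemma of the calculus of variations. It is needed because `weakPartial` is an
arbitrary choice, so its integrability and linearity must be transferred from explicit
representatives. -/
theorem HasWeakPartial.ae_eq {F : Type*} [NormedAddCommGroup F] [NormedSpace ℝ F] [CompleteSpace F]
    {Ω : Set Plane} (hΩ : IsOpen Ω) {f g₁ g₂ : Plane → F} {j : Fin 2}
    (h₁ : HasWeakPartial Ω f j g₁) (h₂ : HasWeakPartial Ω f j g₂) :
    g₁ =ᵐ[volume.restrict Ω] g₂ := by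
  have hint : ∀ {g : Plane → F}, LocallyIntegrableOn g Ω → ∀ φ : Plane → ℝ, IsTestFunction Ω φ →
      Integrable (fun x => φ x • g x) (volume.restrict Ω) := fun {g} hg φ hφ => by
    have h1 : IntegrableOn (fun x => φ x • g x) (tsupport φ) :=
      (hg.integrableOn_compact_subset hφ.support_subset hφ.compact).continuousOn_smul
        hφ.smooth.continuous.continuousOn hφ.compact
    have h2 : Integrable (fun x => φ x • g x) volume :=
      (integrableOn_iff_integrable_of_support_subset fun x hx =>
        subset_tsupport φ fun h0 => hx (by simp [h0])).1 h1
    exact h2.restrict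
  have hloc : LocallyIntegrableOn (g₁ - g₂) Ω :=
    h₁.locallyIntegrable_partial.sub h₂.locallyIntegrable_partial
  have key := hΩ.ae_eq_zero_of_integral_contDiff_smul_eq_zero hloc fun φ h1 h2 h3 => by
    have hφ : IsTestFunction Ω φ := ⟨h1, h2, h3⟩
    have e1 := (h₁.integral_eq φ hφ).symm.trans (h₂.integral_eq φ hφ)
    rw [neg_inj] at e1
    rw [← setIntegral_eq_integral_of_forall_compl_eq_zero (s := Ω) fun x hx => by
      rw [hφ.eq_zero hx, zero_smul]]
    simp only [Pi.sub_apply, smul_sub]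
    rw [integral_sub (hint h₁.locallyIntegrable_partial φ hφ)
      (hint h₂.locallyIntegrable_partial φ hφ), e1, sub_self]
  refine (ae_restrict_iff' hΩ.measurableSet).2 ?_
  filter_upwards [key] with x hx hxΩ using sub_eq_zero.1 (hx hxΩ)

theorem hasWeakPartial_weakPartial {F : Type*} [NormedAddCommGroup F] [NormedSpace ℝ F]
    {Ω : Set Plane} {f g : Plane → F} {j : Fin 2} (h : HasWeakPartial Ω f j g) :
    HasWeakPartial Ω f j (weakPartial Ω f j) := by
  have hex : ∃ g, HasWeakPartial Ω f j g := ⟨g, h⟩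
  rw [weakPartial, dif_pos hex]
  exact hex.choose_spec

theorem HasWeakPartial.mono {F : Type*} [NormedAddCommGroup F] [NormedSpace ℝ F]
    {V Ω : Set Plane} {f g : Plane → F} {j : Fin 2} (h : HasWeakPartial Ω f j g) (hV : V ⊆ Ω) :
    HasWeakPartial V f j g where
  locallyIntegrable := h.locallyIntegrable.mono_set hV
  locallyIntegrable_partial := h.locallyIntegrable_partial.mono_set hV
  integral_eq φ hφ := by
    have h1 := h.integral_eq φ (hφ.mono hV)
    have z1 : ∀ x ∉ V, fderiv ℝ φ x (EuclideanSpace.single j 1) • f x = 0 := fun x hx => by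
      rw [(hφ.fderiv_apply (unitVec j)).eq_zero hx, zero_smul]
    have z2 : ∀ x ∉ V, φ x • g x = 0 := fun x hx => by rw [hφ.eq_zero hx, zero_smul]
    rw [setIntegral_eq_integral_of_forall_compl_eq_zero fun x hx => z1 x fun hv => hx (hV hv),
      setIntegral_eq_integral_of_forall_compl_eq_zero fun x hx => z2 x fun hv => hx (hV hv)] at h1
    rw [setIntegral_eq_integral_of_forall_compl_eq_zero z1,
      setIntegral_eq_integral_of_forall_compl_eq_zero z2, h1]

theorem IsTestFunction.hasWeakPartial {F : Type*} [NormedAddCommGroup F] [NormedSpace ℝ F]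
    {Ω Ω' : Set Plane} {Φ : Plane → F} (hΦ : IsTestFunction Ω' Φ) (j : Fin 2) :
    HasWeakPartial Ω Φ j (fun x => fderiv ℝ Φ x (unitVec j)) where
  locallyIntegrable := hΦ.smooth.continuous.locallyIntegrable.locallyIntegrableOn Ω
  locallyIntegrable_partial := (((hΦ.smooth.continuous_fderiv (by simp)).clm_apply
    continuous_const).locallyIntegrable).locallyIntegrableOn Ω
  integral_eq φ hφ := by
    have z1 : ∀ x ∉ Ω, fderiv ℝ φ x (EuclideanSpace.single j 1) • Φ x = 0 := fun x hx => by
      rw [(hφ.fderiv_apply (unitVec j)).eq_zero hx, zero_smul]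
    have z2 : ∀ x ∉ Ω, φ x • fderiv ℝ Φ x (unitVec j) = 0 := fun x hx => by
      rw [hφ.eq_zero hx, zero_smul]
    have cΦ := (hΦ.smooth.continuous_fderiv (by simp)).clm_apply (continuous_const (y := unitVec j))
    have cφ := hφ.continuous_fderiv_apply (unitVec j)
    rw [setIntegral_eq_integral_of_forall_compl_eq_zero z1,
      setIntegral_eq_integral_of_forall_compl_eq_zero z2,
      integral_smul_fderiv_eq_neg_fderiv_smul_of_integrable, neg_neg]
    · exact (cφ.smul hΦ.smooth.continuous).integrable_of_hasCompactSupport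
        (hφ.hasCompactSupport_fderiv_apply _).smul_right
    · exact (hφ.smooth.continuous.smul cΦ).integrable_of_hasCompactSupport hφ.compact.smul_right
    · exact (hφ.smooth.continuous.smul hΦ.smooth.continuous).integrable_of_hasCompactSupport
        hφ.compact.smul_right
    · exact fun x _ => hφ.smooth.differentiable (by simp) x
    · exact fun x _ => hΦ.smooth.differentiable (by simp) x

theorem HasWeakPartial.add_smul_test {F : Type*} [NormedAddCommGroup F] [NormedSpace ℝ F]
    {Ω Ω' : Set Plane} {f g Φ : Plane → F} {j : Fin 2} (h : HasWeakPartial Ω f j g)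
    (hf : MemLp f 2 (volume.restrict Ω)) (hg : MemLp g 2 (volume.restrict Ω))
    (hΦ : IsTestFunction Ω' Φ) (ε : ℝ) :
    HasWeakPartial Ω (fun x => f x + ε • Φ x) j
      (fun x => g x + ε • fderiv ℝ Φ x (unitVec j)) := by
  have hΦ2 : MemLp Φ 2 (volume.restrict Ω) :=
    hΦ.smooth.continuous.memLp_of_hasCompactSupport hΦ.compact
  have hDΦ2 : MemLp (fun x => fderiv ℝ Φ x (unitVec j)) 2 (volume.restrict Ω) :=
    ((hΦ.smooth.continuous_fderiv (by simp)).clm_apply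
      continuous_const).memLp_of_hasCompactSupport (hΦ.compact.fderiv_apply ℝ _)
  refine ⟨(hf.add (hΦ2.const_smul ε)).locallyIntegrableOn_plane,
    (hg.add (hDΦ2.const_smul ε)).locallyIntegrableOn_plane, fun φ hφ => ?_⟩
  have hd := hφ.fderiv_apply (unitVec j)
  have e1 := h.integral_eq φ hφ
  have e2 := (hΦ.hasWeakPartial (Ω := Ω) j).integral_eq φ hφ
  simp only [smul_add, smul_comm _ ε]
  refine (integral_add (hd.integrable_smul hf) ((hd.integrable_smul hΦ2).smul ε)).trans ?_
  rw [integral_add (hφ.integrable_smul hg)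
    ((hφ.integrable_smul hDΦ2).smul ε : Integrable (fun x => ε • φ x • _) _), neg_add]
  refine congrArg₂ _ e1 ?_
  refine (integral_smul ε _).trans ?_
  rw [e2, integral_smul, smul_neg]

theorem integral_smul_plane_apply {V : Set Plane} {φ : Plane → ℝ} {Ω : Set Plane}
    (hφ : IsTestFunction Ω φ)
    {f : Plane → Plane} (hf : MemLp f 2 (volume.restrict V)) (i : Fin 2) :
    (∫ x in V, φ x • f x) i = ∫ x in V, φ x * f x i := by
  rw [eval_integral_piLp]
  · rfl
  · exact fun i => (memLp_one_iff_integrable.2 (hφ.integrable_smul hf)).eval_piLp i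
      |> memLp_one_iff_integrable.1

theorem HasWeakPartial.component {Ω : Set Plane} {f g : Plane → Plane} {j : Fin 2}
    (h : HasWeakPartial Ω f j g) (hf : MemLp f 2 (volume.restrict Ω))
    (hg : MemLp g 2 (volume.restrict Ω)) (i : Fin 2) {φ : Plane → ℝ} (hφ : IsTestFunction Ω φ) :
    ∫ x in Ω, fderiv ℝ φ x (unitVec j) * f x i = -∫ x in Ω, φ x * g x i := by
  rw [← integral_smul_plane_apply hφ hg, ← integral_smul_plane_apply (hφ.fderiv_apply _) hf,
    h.integral_eq φ hφ]
  rfl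

theorem hasWeakPartial_of_component {V : Set Plane} {f g : Plane → Plane} {j : Fin 2}
    (hf : MemLp f 2 (volume.restrict V)) (hg : MemLp g 2 (volume.restrict V))
    (h : ∀ i, ∀ φ : Plane → ℝ, IsTestFunction V φ →
      ∫ x in V, fderiv ℝ φ x (unitVec j) * f x i = -∫ x in V, φ x * g x i) :
    HasWeakPartial V f j g := by
  refine ⟨hf.locallyIntegrableOn_plane, hg.locallyIntegrableOn_plane, fun φ hφ => ?_⟩
  ext i
  refine (integral_smul_plane_apply (hφ.fderiv_apply (unitVec j)) hf i).trans ?_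
  rw [h i φ hφ, ← integral_smul_plane_apply hφ hg]
  rfl

/-! ### The first variation and the Euler–Lagrange equation. -/

theorem abs_integrand_le {ρ : ℝ → ℝ} {γ s₀ κ : ℝ} (hρ : IsProfile ρ γ s₀ κ) (hγ : γ < 1)
    (ξ : Matrix (Fin 2) (Fin 2) ℝ) : |integrand ρ ξ| ≤ frobSq ξ := by
  have h1 := hρ.nonneg ξ.det
  have h2 := hρ.le_mul_abs ξ.det
  have h3 := abs_det_le_frobSq ξ
  have h4 : 0 ≤ frobSq ξ := by unfold frobSq; positivity
  have h5 : integrand ρ ξ = 1 / 2 * frobSq ξ + ρ ξ.det := rfl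
  rw [h5, abs_of_nonneg (by positivity)]
  nlinarith [abs_nonneg ξ.det]

theorem hasDerivAt_integrand_line {ρ : ℝ → ℝ} (hρ : Differentiable ℝ ρ)
    (ξ N : Matrix (Fin 2) (Fin 2) ℝ) (t : ℝ) :
    HasDerivAt (fun ε : ℝ => integrand ρ (ξ + ε • N))
      (∑ i, ∑ j, stress ρ (ξ + t • N) i j * N i j) t := by
  have hlin : ∀ i j, HasDerivAt (fun ε : ℝ => ξ i j + ε * N i j) (N i j) t := fun i j => by
    simpa using ((hasDerivAt_id t).mul_const (N i j)).const_add (ξ i j)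
  have hdet := ((hlin 0 0).mul (hlin 1 1)).sub ((hlin 0 1).mul (hlin 1 0))
  have hsq := fun i j => (hlin i j).pow 2
  have h1 := (((hsq 0 0).add (hsq 0 1)).add ((hsq 1 0).add (hsq 1 1))).const_mul (1 / 2 : ℝ)
  have hρd : HasDerivAt ρ (deriv ρ (ξ + t • N).det) (((fun ε : ℝ => ξ 0 0 + ε * N 0 0)
      * (fun ε : ℝ => ξ 1 1 + ε * N 1 1) - (fun ε : ℝ => ξ 0 1 + ε * N 0 1)
      * (fun ε : ℝ => ξ 1 0 + ε * N 1 0)) t) := by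
    have : (ξ + t • N).det = ((fun ε : ℝ => ξ 0 0 + ε * N 0 0)
      * (fun ε : ℝ => ξ 1 1 + ε * N 1 1) - (fun ε : ℝ => ξ 0 1 + ε * N 0 1)
      * (fun ε : ℝ => ξ 1 0 + ε * N 1 0)) t := by simp [Matrix.det_fin_two]
    rw [← this]
    exact (hρ _).hasDerivAt
  have h2 := h1.add (hρd.comp t hdet)
  refine (h2.congr_deriv ?_).congr_of_eventuallyEq (Eventually.of_forall fun ε => ?_)
  · simp only [stress]
    generalize deriv ρ (ξ + t • N).det = p
    simp [Fin.sum_univ_two, Matrix.adjugate_fin_two]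
    ring
  · simp [integrand, Matrix.det_fin_two, Fin.sum_univ_two]

/-- Differentiation under the integral computes the derivative at `0`, and uniqueness of derivatives
identifies it with zero. The linear growth of the stress, with `|ε| < 1`, supplies an integrable
majorant. -/
theorem integral_stress_eq_zero_of_hasDerivAt {ρ : ℝ → ℝ} {γ s₀ κ : ℝ} (hρ : IsProfile ρ γ s₀ κ)
    (hγ : γ < 1) {X : Type*} [MeasurableSpace X] {μ : Measure X}
    {W N : X → Matrix (Fin 2) (Fin 2) ℝ} (hW : ∀ i j, MemLp (fun x => W x i j) 2 μ)
    (hN : ∀ i j, MemLp (fun x => N x i j) 2 μ)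
    (h : HasDerivAt (fun ε : ℝ => ∫ x, integrand ρ (W x + ε • N x) ∂μ) 0 0) :
    ∫ x, ∑ i, ∑ j, stress ρ (W x) i j * N x i j ∂μ = 0 := by
  have hWN : ∀ (ε : ℝ) i j, MemLp (fun x => (W x + ε • N x) i j) 2 μ := fun ε i j =>
    (hW i j).add ((hN i j).const_mul ε)
  have hmeas : ∀ ε : ℝ, AEStronglyMeasurable (fun x => integrand ρ (W x + ε • N x)) μ := fun ε => by
    have h1 := fun i j => (hWN ε i j).1
    refine AEStronglyMeasurable.add ?_
      (hρ.smooth.continuous.comp_aestronglyMeasurable (aestronglyMeasurable_det h1))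
    refine AEStronglyMeasurable.const_mul ?_ _
    exact Finset.aestronglyMeasurable_fun_sum _ fun i _ =>
      Finset.aestronglyMeasurable_fun_sum _ fun j _ => (h1 i j).pow 2
  have hint0 : Integrable (fun x => integrand ρ (W x + (0 : ℝ) • N x)) μ := by
    refine Integrable.mono' (g := fun x => frobSq (W x + (0 : ℝ) • N x))
      (integrable_sum_sum fun i j => (hWN 0 i j).integrable_sq) (hmeas 0)
      (Eventually.of_forall fun x => abs_integrand_le hρ hγ _)
  have hder := hasDerivAt_integral_of_dominated_loc_of_deriv_le (μ := μ)
    (F := fun (ε : ℝ) x => integrand ρ (W x + ε • N x))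
    (F' := fun (ε : ℝ) x => ∑ i, ∑ j, stress ρ (W x + ε • N x) i j * N x i j)
    (x₀ := 0) (s := Metric.ball 0 1)
    (bound := fun x => ∑ i, ∑ j, (∑ k, ∑ l, (|W x k l| + |N x k l|)) * |N x i j|)
    (Metric.ball_mem_nhds 0 one_pos) (Eventually.of_forall hmeas) hint0 ?_ ?_ ?_ ?_
  · have := hder.2.unique h
    simpa using this
  · exact (integrable_sum_sum fun i j =>
      (hρ.memLp_stress hγ (hWN 0) i j).integrable_mul (hN i j)).1
  · refine Eventually.of_forall fun x ε hε => ?_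
    refine (norm_sum_le _ _).trans (Finset.sum_le_sum fun i _ => ?_)
    refine (norm_sum_le _ _).trans (Finset.sum_le_sum fun j _ => ?_)
    rw [norm_mul, Real.norm_eq_abs, Real.norm_eq_abs]
    refine mul_le_mul_of_nonneg_right ?_ (abs_nonneg _)
    refine (stress_apply_abs_le hρ hγ _ i j).trans ?_
    refine Finset.sum_le_sum fun k _ => Finset.sum_le_sum fun l _ => ?_
    refine (abs_add_le _ _).trans (add_le_add le_rfl ?_)
    have hε1 : |ε| ≤ 1 := by
      have := mem_ball_zero_iff.1 hε
      exact this.le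
    simp only [Matrix.smul_apply, smul_eq_mul, abs_mul]
    exact mul_le_of_le_one_left (abs_nonneg _) hε1
  · have hs : MemLp (fun x => ∑ k, ∑ l, (|W x k l| + |N x k l|)) 2 μ :=
      memLp_finsetSum _ fun k _ => memLp_finsetSum _ fun l _ => (hW k l).abs.add (hN k l).abs
    exact integrable_sum_sum fun i j => hs.integrable_mul (hN i j).abs
  · exact Eventually.of_forall fun x ε _ =>
      hasDerivAt_integrand_line hρ.differentiable (W x) (N x) ε

theorem MemSobolev.memLp_weakPartial {Ω : Set Plane} (hΩ : IsOpen Ω) {u : Plane → Plane}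
    (hu : MemSobolev 2 Ω 1 u) (j : Fin 2) :
    HasWeakPartial Ω u j (weakPartial Ω u j) ∧
      MemLp (weakPartial Ω u j) 2 (volume.restrict Ω) := by
  obtain ⟨g, hg, hg2⟩ := hu.2 j
  have h1 := hasWeakPartial_weakPartial hg
  exact ⟨h1, (memLp_congr_ae (hg.ae_eq hΩ h1)).1 hg2⟩

theorem fderiv_toLp_apply {φ : Fin 2 → Plane → ℝ} (hφ : ∀ i, ContDiff ℝ ∞ (φ i)) (x y : Plane)
    (i : Fin 2) : (fderiv ℝ (fun x => (WithLp.toLp 2 fun i => φ i x : Plane)) x y) i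
      = fderiv ℝ (φ i) x y := by
  have hs : ContDiff ℝ ∞ (fun x => (WithLp.toLp 2 fun i => φ i x : Plane)) :=
    contDiff_euclidean.2 hφ
  have h1 := ((EuclideanSpace.proj i : Plane →L[ℝ] ℝ).hasFDerivAt.comp x
    (hs.differentiable (by simp) x).hasFDerivAt).fderiv
  have h2 : (EuclideanSpace.proj i : Plane →L[ℝ] ℝ) ∘
    (fun x => (WithLp.toLp 2 fun i => φ i x : Plane)) = φ i := rfl
  rw [h2] at h1
  rw [h1]
  rfl

theorem isTestFunction_toLp {Ω : Set Plane} {φ : Fin 2 → Plane → ℝ}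
    (hφ : ∀ i, IsTestFunction Ω (φ i)) :
    IsTestFunction Ω (fun x => (WithLp.toLp 2 fun i => φ i x : Plane)) := by
  have hs : tsupport (fun x => (WithLp.toLp 2 fun i => φ i x : Plane))
      ⊆ tsupport (φ 0) ∪ tsupport (φ 1) := by
    refine closure_minimal (fun x hx => ?_) ((isClosed_tsupport _).union (isClosed_tsupport _))
    by_contra hx'
    rw [mem_union, not_or] at hx'
    refine hx ?_
    ext i
    fin_cases i
    · have h0 : φ 0 x = 0 := image_eq_zero_of_notMem_tsupport hx'.1
      exact h0
    · have h0 : φ 1 x = 0 := image_eq_zero_of_notMem_tsupport hx'.2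
      exact h0
  refine ⟨contDiff_euclidean.2 fun i => (hφ i).smooth, ?_,
    hs.trans (union_subset (hφ 0).support_subset (hφ 1).support_subset)⟩
  exact HasCompactSupport.of_support_subset_isCompact
    ((hφ 0).compact.isCompact.union (hφ 1).compact.isCompact) ((subset_tsupport _).trans hs)

theorem IsStationaryPoint.euler_lagrange {ρ : ℝ → ℝ} {γ s₀ κ : ℝ} (hρ : IsProfile ρ γ s₀ κ)
    (hγ : γ < 1) {Ω : Set Plane} (hΩ : IsOpen Ω) {u : Plane → Plane}
    (hu : IsStationaryPoint ρ Ω u) {φ : Fin 2 → Plane → ℝ} (hφ : ∀ i, IsTestFunction Ω (φ i)) :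
    ∫ x in Ω, ∑ i, ∑ j, stress ρ (weakGrad Ω u x) i j * fderiv ℝ (φ i) x (unitVec j) = 0 := by
  have hp := hu.memSobolev.memLp_weakPartial hΩ
  set Φ : Plane → Plane := fun x => WithLp.toLp 2 fun i => φ i x with hΦdef
  have hΦ : IsTestFunction Ω Φ := isTestFunction_toLp hφ
  refine integral_stress_eq_zero_of_hasDerivAt hρ hγ (μ := volume.restrict Ω) (W := weakGrad Ω u)
    (N := fun x => Matrix.of fun i j => fderiv ℝ (φ i) x (unitVec j))
    (fun i j => (hp j).2.eval_piLp i)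
    (fun i j => (hφ i).memLp_fderiv_apply _ 2 _) ?_
  have hvar := hu.firstVariation Φ hΦ
  refine hvar.congr_of_eventuallyEq (Eventually.of_forall fun ε => ?_)
  -- The energy of `u + ε Φ` uses an independently chosen weak gradient, which agrees with `∇u + ε
  -- ∇Φ` only almost everywhere.
  have hae : ∀ j, weakPartial Ω (fun x => u x + ε • Φ x) j =ᵐ[volume.restrict Ω]
      fun x => weakPartial Ω u j x + ε • fderiv ℝ Φ x (unitVec j) := fun j => by
    have h1 := (hp j).1.add_smul_test hu.memSobolev.1 (hp j).2 hΦ ε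
    exact (hasWeakPartial_weakPartial h1).ae_eq hΩ h1
  refine integral_congr_ae ?_
  filter_upwards [hae 0, hae 1] with x h0 h1
  congr 1
  ext i j
  simp only [weakGrad, Matrix.add_apply, Matrix.smul_apply, Matrix.of_apply, smul_eq_mul]
  rw [← fderiv_toLp_apply fun i => (hφ i).smooth]
  fin_cases j
  · simp only [Fin.zero_eta, h0]; rfl
  · simp only [Fin.mk_one, h1]; rfl

/-- Extension by zero makes translations act on `L²` of the plane. The extended `u` need not be
Sobolev across the boundary, but the weak identities are tested only with functions supported in
`Ω`, so they survive. -/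
theorem IsStationaryPoint.isWeakSolution {ρ : ℝ → ℝ} {γ s₀ κ : ℝ} (hρ : IsProfile ρ γ s₀ κ)
    (hγ : γ < 1) {Ω : Set Plane} (hΩ : IsOpen Ω) {u : Plane → Plane}
    (hu : IsStationaryPoint ρ Ω u) :
    IsWeakSolution ρ Ω (fun i => Ω.indicator fun x => u x i)
      (fun x => Matrix.of fun i j => Ω.indicator (fun x => weakPartial Ω u j x i) x) where
  memLp i := (memLp_indicator_iff_restrict hΩ.measurableSet).2 (hu.memSobolev.1.eval_piLp i)
  memLp_grad i j := (memLp_indicator_iff_restrict hΩ.measurableSet).2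
    ((hu.memSobolev.memLp_weakPartial hΩ j).2.eval_piLp i)
  weak i j φ hφ := by
    have hp := hu.memSobolev.memLp_weakPartial hΩ j
    have h1 := hp.1.component hu.memSobolev.1 hp.2 i hφ
    rw [← integral_indicator hΩ.measurableSet, ← integral_indicator hΩ.measurableSet] at h1
    simpa only [Matrix.of_apply, indicator_mul_right] using h1
  euler φ hφ := by
    have h1 := hu.euler_lagrange hρ hγ hΩ hφ
    rw [← h1, ← setIntegral_eq_integral_of_forall_compl_eq_zero (s := Ω)]
    · refine setIntegral_congr_fun hΩ.measurableSet fun x hx => ?_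
      have : (Matrix.of fun i j => Ω.indicator (fun x => weakPartial Ω u j x i) x)
          = weakGrad Ω u x := by
        ext i j
        simp [weakGrad, hx]
      simp only [this]
    · intro x hx
      refine Finset.sum_eq_zero fun i _ => Finset.sum_eq_zero fun j _ => ?_
      rw [((hφ i).fderiv_apply (unitVec j)).eq_zero hx, mul_zero]

/-! ### Local `W^{2,2}` regularity. -/

theorem theorem2p3 (ρ : ℝ → ℝ) (γ s₀ κ : ℝ) (hρ : IsProfile ρ γ s₀ κ) (hγ : γ < 1)
    (Ω : Set Plane) (hΩ : IsOpen Ω) (hΩb : Bornology.IsBounded Ω)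
    (u : Plane → Plane) (hu : IsStationaryPoint ρ Ω u) :
    MemSobolevLoc 2 Ω 2 u := by
  intro V hV hVc hVΩ
  have hVsub : V ⊆ Ω := subset_closure.trans hVΩ
  have hμ : volume.restrict V ≤ (volume.restrict Ω : Measure Plane) :=
    Measure.restrict_mono hVsub le_rfl
  have hsol := hu.isWeakSolution hρ hγ hΩ
  obtain ⟨η, hη, hη0, hη1, hηV⟩ := exists_cutoff hVc hΩ hVΩ
  refine ⟨hu.memSobolev.1.mono_measure hμ, fun j => ?_⟩
  have hp := hu.memSobolev.memLp_weakPartial hΩ j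
  have hpV := hp.2.mono_measure hμ
  refine ⟨weakPartial Ω u j, hp.1.mono hVsub, hpV, fun k => ?_⟩
  obtain ⟨δ, hδ, C, -, hC⟩ := hsol.exists_normTwo_diff_le hρ hγ hΩ hη hη0 hη1 k
  -- Each component of `∂_j u`, extended by zero, has a weak `k`-th derivative on `V`, because `η =
  -- 1` there.
  choose g hg hgw using fun i => exists_weakDeriv_of_diff_bound (V := V) (hsol.memLp_grad i j) hη
    (fun x hx => hηV x (subset_closure hx)) hδ (fun h hh => hC h hh i j)
  have hgV : MemLp (fun x => (WithLp.toLp 2 fun i => g i x : Plane)) 2 (volume.restrict V) :=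
    MemLp.of_eval_piLp fun i => (hg i).mono_measure Measure.restrict_le_self
  refine ⟨_, hasWeakPartial_of_component hpV hgV fun i φ hφ => ?_, hgV⟩
  have h1 := hgw i φ hφ
  have e1 := setIntegral_eq_integral_of_forall_compl_eq_zero (μ := volume) (s := V)
    (f := fun x => fderiv ℝ φ x (unitVec k) * Ω.indicator (fun x => weakPartial Ω u j x i) x)
    fun x hx => by rw [(hφ.fderiv_apply (unitVec k)).eq_zero hx, zero_mul]
  have e2 := setIntegral_eq_integral_of_forall_compl_eq_zero (μ := volume) (s := V)
    (f := fun x => φ x * g i x) fun x hx => by rw [hφ.eq_zero hx, zero_mul]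
  refine Eq.trans ?_ ((e1.trans h1).trans (congrArg Neg.neg e2.symm))
  refine setIntegral_congr_fun hV.measurableSet fun x hx => ?_
  simp [hVsub hx]
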